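/- \textbf{Setting.} A linear map $T:\mathrm{Mat}_{n\times n}(\mathbb C)\to \mathrm{Mat}_{m\times m}(\mathbb C)$ is \emph{completely positive} if $T(X)=\sum_{i=1}^r A_iXA_i^\dagger$ for some finite family of $m\times n$ matrices $A_i$ (\emph{Kraus operators}). $T^*$ is its adjoint for $\langle A,B\rangle=\operatorname{Tr}A^\dagger B$, and for $g\in \mathrm{GL}_m(\mathbb C)$, $h\in\mathrm{GL}_n(\mathbb C)$ put $T_{g,h}(X)=g^\dagger T(hXh^\dagger)g$. With $\|A\|=\sqrt{\operatorname{Tr}AA^\dagger}$, $T$ is \emph{approximately $G\times H$-scalable to $(A\to B,\,C\to D)$}, where $G\subset\mathrm{GL}_m(\mathbb C)$ and $H\subset\mathrm{GL}_n(\mathbb C)$, if for every $\epsilon>0$ there are $g\in G$, $h\in H$ with $\|T_{g,h}(A)-B\|\le\epsilon$ and $\|T_{g,h}^*(C)-D\|\le\epsilon$. Let $B_k\subset\mathrm{GL}_k(\mathbb C)$ be the group of invertible upper triangular matrices and let $V_j\subset\mathbb C^k$ be the span of the first $j$ standard basis vectors. For a non-increasing $\mathbf a=(a_1,\dots,a_k)$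 write $\Delta a_j=a_j-a_{j+1}$ with $a_{k+1}:=0$, and, for $k\times k$ positive semidefinite $X$, $$\det(\operatorname{diag}\mathbf a,X)=\prod_{j=1}^k\bigl(\det \eta_jX\eta_j^\dagger\bigr)^{\Delta a_j},\qquad 0^0:=1,$$ where $\eta_j:\mathbb C^k\to\mathbb C^j$ is the projection to the first $j$ coordinates. For $P=\operatorname{diag}\mathbf p$ ($n\times n$) and $Q=\operatorname{diag}\mathbf q$ ($m\times m$) define $$\operatorname{cap}(T,P,Q)=\inf_{h\in B_n}\frac{\det(Q,T(hPh^\dagger))}{\det(P,h^\dagger h)} .$$ A pair of subspaces $L\subset\mathbb C^m$, $R\subset\mathbb C^n$ is \emph{$T$-independent} if $L\subset(A_iR)^\perp$ for all $i$; $T$ is \emph{$(P,Q)$-rank-nondecreasing} if $$\sum_{i=1}^m\Delta q_i\dim(V_i\cap L)+\sum_{j=1}^n\Delta p_j\dim(V_j\cap R)\le\operatorname{Tr}P$$ for all $T$-independent $(L,R)$. For a completely positive $S$ on $N\times N$ matrices, $\operatorname{cap}S=\inf_{X\succ0}\det S(X)/\det X$, and $S$ is \emph{rank-nondecreasing} if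 $\operatorname{rank}S(X)\ge\operatorname{rank}X$ for all $X\succeq0$. \textbf{Theorem.} Let $\mathbf p=(p_1\ge\dots\ge p_n)$ and $\mathbf q=(q_1\ge\dots\ge q_m)$ be non-increasing sequences of nonnegative integers, each with sum $N$, let $P=\operatorname{diag}\mathbf p$, $Q=\operatorname{diag}\mathbf q$, and let $T:\mathrm{Mat}_{n\times n}(\mathbb C)\to\mathrm{Mat}_{m\times m}(\mathbb C)$ be completely positive. For a partition $\lambda=(\lambda_1\ge\dots\ge\lambda_k\geq 0)$ of $l$ with conjugate partition $\lambda'$ let $$G_\lambda:\mathrm{Mat}_{k\times k}(\mathbb C)\to\mathrm{Mat}_{l\times l}(\mathbb C),\qquad G_\lambda(X)=\bigoplus_{i=1}^{\lambda_1}\eta_{\lambda_i'}X\eta_{\lambda_i'}^\dagger,$$ and let $\operatorname{trun}_{P,Q}T=G_{\mathbf q}\circ T\circ G_{\mathbf p}^*:\mathrm{Mat}_{N\times N}(\mathbb C)\to\mathrm{Mat}_{N\times N}(\mathbb C)$. Then: \begin{enumerate} \item $\operatorname{trun}_{P,Q}T$ is completely positive. \item If, in addition, all $p_i$ and all $q_j$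 are positive, then $\operatorname{trun}_{P,Q}T$ is approximately $\mathrm{GL}_N(\mathbb C)\times\mathrm{GL}_N(\mathbb C)$-scalable to $(I_N\to I_N,\,I_N\to I_N)$ if and only if $T$ is approximately $B_m\times B_n$-scalable to $(I_n\to Q,\,I_m\to P)$. \item $\operatorname{cap}(\operatorname{trun}_{P,Q}T)=\operatorname{cap}(T,P,Q)$. \item $\operatorname{trun}_{P,Q}T$ is rank-nondecreasing if and only if $T$ is $(P,Q)$-rank-nondecreasing. \end{enumerate} -/

import Mathlib

open scoped Matrix BigOperators ComplexOrder

noncomputable section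

namespace OpScaling

/-! ### Completely positive maps and scalings -/

/-- `A` is a family of Kraus operators of `T`, that is `T X = ∑ i, A i * X * (A i)ᴴ`. -/
def IsKraus {n m r : ℕ}
    (T : Matrix (Fin n) (Fin n) ℂ →ₗ[ℂ] Matrix (Fin m) (Fin m) ℂ)
    (A : Fin r → Matrix (Fin m) (Fin n) ℂ) : Prop :=
  ∀ X, T X = ∑ i, A i * X * (A i)ᴴ

/-- A completely positive map: one that has a finite family of Kraus operators. -/
def IsCompletelyPositive {n m : ℕ}
    (T : Matrix (Fin n) (Fin n) ℂ →ₗ[ℂ] Matrix (Fin m) (Fin m) ℂ) : Prop :=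
  ∃ (r : ℕ) (A : Fin r → Matrix (Fin m) (Fin n) ℂ), IsKraus T A

/-- The adjoint `T*` of `T` in the trace inner product `⟨A, B⟩ = Tr (Aᴴ B)`, given by its entries;
`trace_dual` below is its characterizing identity, `IsKraus.dual` its Kraus form. -/
def dual {n m : ℕ} (T : Matrix (Fin n) (Fin n) ℂ →ₗ[ℂ] Matrix (Fin m) (Fin m) ℂ) :
    Matrix (Fin m) (Fin m) ℂ →ₗ[ℂ] Matrix (Fin n) (Fin n) ℂ where
  toFun Y := Matrix.of fun i j => ((T (Matrix.single i j 1))ᴴ * Y).trace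
  map_add' Y Z := by
    ext i j
    simp [Matrix.mul_add]
  map_smul' c Y := by
    ext i j
    simp

/-- The scaling `T_{g,h} : X ↦ gᴴ T(h X hᴴ) g`. -/
def scaling {n m : ℕ} (T : Matrix (Fin n) (Fin n) ℂ →ₗ[ℂ] Matrix (Fin m) (Fin m) ℂ)
    (g : GL (Fin m) ℂ) (h : GL (Fin n) ℂ) :
    Matrix (Fin n) (Fin n) ℂ →ₗ[ℂ] Matrix (Fin m) (Fin m) ℂ where
  toFun X := (g : Matrix (Fin m) (Fin m) ℂ)ᴴ *
    T ((h : Matrix (Fin n) (Fin n) ℂ) * X * (h : Matrix (Fin n) (Fin n) ℂ)ᴴ) *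
    (g : Matrix (Fin m) (Fin m) ℂ)
  map_add' X Y := by simp [Matrix.mul_add, Matrix.add_mul]
  map_smul' c X := by simp

/-- The norm `‖A‖ = √(Tr A Aᴴ)`. -/
def hsNorm {k : ℕ} (A : Matrix (Fin k) (Fin k) ℂ) : ℝ :=
  Real.sqrt (A * Aᴴ).trace.re

/-- `T` is approximately `G × H`-scalable to `(A → B, C → D)`: for every `ε > 0` some scaling
`T' = T_{g,h}` with `g ∈ G`, `h ∈ H` has `‖T'(A) - B‖ ≤ ε` and `‖T'*(C) - D‖ ≤ ε`. -/
def IsApproxScalable {n m : ℕ}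
    (T : Matrix (Fin n) (Fin n) ℂ →ₗ[ℂ] Matrix (Fin m) (Fin m) ℂ)
    (G : Set (GL (Fin m) ℂ)) (H : Set (GL (Fin n) ℂ))
    (A : Matrix (Fin n) (Fin n) ℂ) (B C : Matrix (Fin m) (Fin m) ℂ)
    (D : Matrix (Fin n) (Fin n) ℂ) : Prop :=
  ∀ ε : ℝ, 0 < ε → ∃ g ∈ G, ∃ h ∈ H,
    hsNorm (scaling T g h A - B) ≤ ε ∧ hsNorm (dual (scaling T g h) C - D) ≤ ε

/-- The invertible upper triangular matrices, i.e. those preserving the standard flag. -/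
def upperGL (k : ℕ) : Set (GL (Fin k) ℂ) :=
  {g | (g : Matrix (Fin k) (Fin k) ℂ).BlockTriangular id}

/-! ### Rank-nondecreasingness -/

/-- `Δ a_i = a_i - a_{i+1}`, with `a_{k+1} = 0`. -/
def gap {k : ℕ} (a : Fin k → ℝ) (i : Fin k) : ℝ :=
  a i - if h : (i : ℕ) + 1 < k then a ⟨i + 1, h⟩ else 0

/-- The member of the standard flag spanned by the standard basis vectors up to index `i`
(a space of dimension `i + 1`, indices starting at `0`). -/
def stdFlag {k : ℕ} (i : Fin k) : Submodule ℂ (Fin k → ℂ) :=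
  Submodule.span ℂ {v | ∃ j : Fin k, j ≤ i ∧ v = Pi.single j 1}

/-- `(L, R)` is `T`-independent: `L ⊆ (A i R)^⊥` for all Kraus operators `A i` of `T`. For a
completely positive `T` this does not depend on the Kraus operators, see
`IsKraus.isIndependent_iff`. -/
def IsIndependent {n m : ℕ}
    (T : Matrix (Fin n) (Fin n) ℂ →ₗ[ℂ] Matrix (Fin m) (Fin m) ℂ)
    (L : Submodule ℂ (Fin m → ℂ)) (R : Submodule ℂ (Fin n → ℂ)) : Prop :=
  ∃ (r : ℕ) (A : Fin r → Matrix (Fin m) (Fin n) ℂ), IsKraus T A ∧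
    ∀ i, ∀ x ∈ L, ∀ y ∈ R, star x ⬝ᵥ (A i *ᵥ y) = 0

/-- `T` is `(P, Q)`-rank-nondecreasing, for `P = diag p` and `Q = diag q`. -/
def IsRankNondecreasingRel {n m : ℕ}
    (T : Matrix (Fin n) (Fin n) ℂ →ₗ[ℂ] Matrix (Fin m) (Fin m) ℂ)
    (p : Fin n → ℝ) (q : Fin m → ℝ) : Prop :=
  ∀ (L : Submodule ℂ (Fin m → ℂ)) (R : Submodule ℂ (Fin n → ℂ)), IsIndependent T L R →
    ∑ i, gap q i * (Module.finrank ℂ ↥(stdFlag i ⊓ L) : ℝ) +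
      ∑ j, gap p j * (Module.finrank ℂ ↥(stdFlag j ⊓ R) : ℝ) ≤ ∑ j, p j

/-- `S` is rank-nondecreasing: `rank S(X) ≥ rank X` for all `X ⪰ 0`. -/
def IsRankNondecreasing {k : ℕ}
    (S : Matrix (Fin k) (Fin k) ℂ →ₗ[ℂ] Matrix (Fin k) (Fin k) ℂ) : Prop :=
  ∀ X : Matrix (Fin k) (Fin k) ℂ, X.PosSemidef → X.rank ≤ (S X).rank

/-! ### Capacity -/

/-- The upper-left `j × j` corner `η_j X η_jᴴ` of `X`. -/
def corner {k j : ℕ} (hj : j ≤ k) (X : Matrix (Fin k) (Fin k) ℂ) : Matrix (Fin j) (Fin j) ℂ :=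
  X.submatrix (Fin.castLE hj) (Fin.castLE hj)

/-- The relative determinant `det(A, X) = ∏ j, (det η_j X η_jᴴ) ^ Δ a_j` for `A = diag a`, with
`0 ^ 0 = 1`. It is used for positive semidefinite `X`, whose principal minors are nonnegative
reals; hence the real parts. -/
def relDet {k : ℕ} (a : Fin k → ℝ) (X : Matrix (Fin k) (Fin k) ℂ) : ℝ :=
  ∏ j : Fin k, (corner (Nat.succ_le_of_lt j.isLt) X).det.re ^ gap a j

/-- The capacity `cap(T, P, Q)`, for `P = diag p` and `Q = diag q`. -/
def capRel {n m : ℕ} (T : Matrix (Fin n) (Fin n) ℂ →ₗ[ℂ] Matrix (Fin m) (Fin m) ℂ)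
    (p : Fin n → ℝ) (q : Fin m → ℝ) : ℝ :=
  ⨅ h : upperGL n,
    relDet q (T ((h.1 : Matrix (Fin n) (Fin n) ℂ) * Matrix.diagonal (fun i => (p i : ℂ)) *
        (h.1 : Matrix (Fin n) (Fin n) ℂ)ᴴ)) /
      relDet p ((h.1 : Matrix (Fin n) (Fin n) ℂ)ᴴ * (h.1 : Matrix (Fin n) (Fin n) ℂ))

/-- The capacity `cap S = inf_{X ≻ 0} det S(X) / det X`. -/
def cap {k : ℕ} (S : Matrix (Fin k) (Fin k) ℂ →ₗ[ℂ] Matrix (Fin k) (Fin k) ℂ) : ℝ :=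
  ⨅ X : {X : Matrix (Fin k) (Fin k) ℂ // X.PosDef}, (S X.1).det.re / X.1.det.re

/-! ### The reduction -/

/-- The conjugate partition: `conjPart lam j` is the number of `i` with `lam i > j`, for
`j < lam_1 = max lam`; indices start at `0`. -/
def conjPart {k : ℕ} (lam : Fin k → ℕ) (j : Fin (Finset.univ.sup lam)) : ℕ :=
  (Finset.univ.filter fun i => (j : ℕ) < lam i).card

theorem conjPart_le {k : ℕ} (lam : Fin k → ℕ) (j : Fin (Finset.univ.sup lam)) :
    conjPart lam j ≤ k := by
  simpa [conjPart] using Finset.card_filter_le (Finset.univ : Finset (Fin k))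
    (fun i => (j : ℕ) < lam i)

theorem sum_conjPart {k : ℕ} (lam : Fin k → ℕ) : ∑ j, conjPart lam j = ∑ i, lam i := by
  simp only [conjPart, Finset.card_filter]
  rw [Finset.sum_comm]
  refine Finset.sum_congr rfl fun i _ => ?_
  have hi : lam i ≤ Finset.univ.sup lam := Finset.le_sup (Finset.mem_univ i)
  rw [Fin.sum_univ_eq_sum_range (fun j => if j < lam i then 1 else 0), ← Finset.card_filter]
  have : (Finset.range (Finset.univ.sup lam)).filter (fun j => j < lam i)
      = Finset.range (lam i) := by
    ext j
    simp only [Finset.mem_filter, Finset.mem_range]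
    omega
  rw [this, Finset.card_range]

/-- The order in which the blocks of sizes `lam'_1, lam'_2, …` are put one after another
along the diagonal of an `l × l` matrix. -/
def blockEquiv {k l : ℕ} (lam : Fin k → ℕ) (hl : ∑ i, lam i = l) :
    (Σ j : Fin (Finset.univ.sup lam), Fin (conjPart lam j)) ≃ Fin l :=
  finSigmaFinEquiv.trans (finCongr ((sum_conjPart lam).trans hl))

/-- `G_lam : X ↦ ⨁_{j = 1}^{lam_1} η_{lam'_j} X η_{lam'_j}ᴴ`, for a partition `lam` of `l`. -/
def gadget {k l : ℕ} (lam : Fin k → ℕ) (hl : ∑ i, lam i = l) :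
    Matrix (Fin k) (Fin k) ℂ →ₗ[ℂ] Matrix (Fin l) (Fin l) ℂ where
  toFun X := Matrix.reindex (blockEquiv lam hl) (blockEquiv lam hl)
    (Matrix.blockDiagonal' fun j => corner (conjPart_le lam j) X)
  map_add' X Y := by
    have h : (fun j => corner (conjPart_le lam j) (X + Y)) =
        (fun j => corner (conjPart_le lam j) X) + fun j => corner (conjPart_le lam j) Y := rfl
    rw [h, Matrix.blockDiagonal'_add]
    rfl
  map_smul' c X := by
    have h : (fun j => corner (conjPart_le lam j) (c • X)) =
        c • fun j => corner (conjPart_le lam j) X := rfl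
    rw [h, Matrix.blockDiagonal'_smul]
    rfl

/-- The reduction `trun_{P,Q} T = G_q ∘ T ∘ G_p*`, for `P = diag p` and `Q = diag q`. -/
def trun {n m N : ℕ} (p : Fin n → ℕ) (q : Fin m → ℕ)
    (hp : ∑ i, p i = N) (hq : ∑ i, q i = N)
    (T : Matrix (Fin n) (Fin n) ℂ →ₗ[ℂ] Matrix (Fin m) (Fin m) ℂ) :
    Matrix (Fin N) (Fin N) ℂ →ₗ[ℂ] Matrix (Fin N) (Fin N) ℂ :=
  gadget q hq ∘ₗ T ∘ₗ dual (gadget p hp)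

/-! ### Consistency of the definitions -/

/-- `⟨X, T*(Y)⟩ = ⟨T(X), Y⟩`. -/
theorem trace_dual {n m : ℕ} (T : Matrix (Fin n) (Fin n) ℂ →ₗ[ℂ] Matrix (Fin m) (Fin m) ℂ)
    (X : Matrix (Fin n) (Fin n) ℂ) (Y : Matrix (Fin m) (Fin m) ℂ) :
    (Xᴴ * dual T Y).trace = ((T X)ᴴ * Y).trace := by
  conv_rhs => rw [Matrix.matrix_eq_sum_single X]
  have h : ∀ i j, T (Matrix.single i j (X i j)) = X i j • T (Matrix.single i j 1) := by
    intro i j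
    rw [← map_smul, Matrix.smul_single, smul_eq_mul, mul_one]
  simp only [map_sum, h, Matrix.conjTranspose_sum, Matrix.conjTranspose_smul, Finset.sum_mul,
    Matrix.trace_sum, Matrix.smul_mul, Matrix.trace_smul]
  simp only [Matrix.trace, Matrix.diag_apply, Matrix.mul_apply, Matrix.conjTranspose_apply, dual,
    LinearMap.coe_mk, AddHom.coe_mk, Matrix.of_apply, smul_eq_mul]
  rw [Finset.sum_comm]

theorem IsKraus.dual {n m r : ℕ}
    {T : Matrix (Fin n) (Fin n) ℂ →ₗ[ℂ] Matrix (Fin m) (Fin m) ℂ}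
    {A : Fin r → Matrix (Fin m) (Fin n) ℂ} (hA : IsKraus T A) (Y : Matrix (Fin m) (Fin m) ℂ) :
    OpScaling.dual T Y = ∑ i, (A i)ᴴ * Y * A i := by
  have key : ∀ X : Matrix (Fin n) (Fin n) ℂ,
      (X * OpScaling.dual T Y).trace = (X * ∑ i, (A i)ᴴ * Y * A i).trace := by
    intro X
    have h := trace_dual T Xᴴ Y
    rw [Matrix.conjTranspose_conjTranspose] at h
    rw [h, hA, Matrix.conjTranspose_sum, Finset.sum_mul, Finset.mul_sum, Matrix.trace_sum,
      Matrix.trace_sum]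
    refine Finset.sum_congr rfl fun i _ => ?_
    simp only [Matrix.conjTranspose_mul, Matrix.conjTranspose_conjTranspose]
    rw [Matrix.mul_assoc, Matrix.trace_mul_comm]
    simp only [Matrix.mul_assoc]
  exact Matrix.ext_iff_trace_mul_left.2 key

/-- `T`-independence can be read off any family of Kraus operators. -/
theorem IsKraus.isIndependent_iff {n m r : ℕ}
    {T : Matrix (Fin n) (Fin n) ℂ →ₗ[ℂ] Matrix (Fin m) (Fin m) ℂ}
    {A : Fin r → Matrix (Fin m) (Fin n) ℂ} (hA : IsKraus T A)
    (L : Submodule ℂ (Fin m → ℂ)) (R : Submodule ℂ (Fin n → ℂ)) :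
    IsIndependent T L R ↔ ∀ i, ∀ x ∈ L, ∀ y ∈ R, star x ⬝ᵥ (A i *ᵥ y) = 0 := by
  have key : ∀ {s : ℕ} {B : Fin s → Matrix (Fin m) (Fin n) ℂ}, IsKraus T B →
      ∀ x y, star x ⬝ᵥ (T (Matrix.vecMulVec y (star y)) *ᵥ x) =
        ∑ i, (star x ⬝ᵥ (B i *ᵥ y)) * star (star x ⬝ᵥ (B i *ᵥ y)) := by
    intro s B hB x y
    rw [hB, Matrix.sum_mulVec, dotProduct_sum]
    refine Finset.sum_congr rfl fun i _ => ?_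
    rw [Matrix.mul_vecMulVec, Matrix.vecMulVec_mul, Matrix.vecMulVec_mulVec,
      ← Matrix.star_mulVec]
    rw [dotProduct_smul, ← Matrix.star_dotProduct_star, star_star]
    simp [dotProduct_comm]
  have zero : ∀ {s : ℕ} {B : Fin s → Matrix (Fin m) (Fin n) ℂ}, IsKraus T B →
      ∀ x y, star x ⬝ᵥ (T (Matrix.vecMulVec y (star y)) *ᵥ x) = 0 ↔
        ∀ i, star x ⬝ᵥ (B i *ᵥ y) = 0 := by
    intro s B hB x y
    rw [key hB, Finset.sum_eq_zero_iff_of_nonneg]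
    · simp
    · intro i _
      exact mul_star_self_nonneg _
  constructor
  · rintro ⟨s, B, hB, h⟩ i x hx y hy
    exact (zero hA x y).1 ((zero hB x y).2 fun i => h i x hx y hy) i
  · intro h
    exact ⟨r, A, hA, h⟩

end OpScaling

end

noncomputable section

namespace OpScaling


/-! ### Coordinates of the gadget -/

variable {k l : ℕ}

/-! Everything rests on the covariance of `gadget` under upper triangular matrices. Each block of
`gadget lam hl X` is a corner of `X`, and an upper triangular `U` preserves the standard flag, so
taking corners is multiplicative when the right factor is upper triangular (`gadget_mul`). Hence
`gadget` carries `Uᴴ * X * U` to the conjugate of `gadget X` by `gadget U`, and its adjoint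
satisfies the dual identity (`gadget_conj`, `dual_gadget_conj`). Moreover `gadget` is unital, its
adjoint sends `1` to `diag lam`, and a block of length `j` occurs `Δ lam_j` times, so `det (gadget
X)` is the relative determinant and the dimension of a lifted subspace is the weighted sum of flag
dimensions.

Capacity: write `P = diag p`. An upper triangular `h` corresponds to `X = K Kᴴ` with `K = gadget h`,
whose image under the adjoint is `h P hᴴ`; the two quotients agree. Conversely the image of any `X ≻
0` has the form `h P hᴴ`, and among all matrices with this image `K Kᴴ` has the largest determinant,
by the arithmetic-geometric mean inequality (`det_le_of_dual_gadget_eq`). So the two infima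
coincide.

Rank: the Kraus operators of `trun` are those of `T` composed with block inclusions, so independence
of a pair for `trun` depends only on the blocks of its vectors. The largest spaces with prescribed
blocks are the lifts of subspaces, and their dimensions are the sums in the relative condition
(`finrank_blockLift`).

Scalability: triangular scalings of `T` lift to scalings of `trun` after the corrections `P^(-1/2)`
and `Q^(-1/2)`. A general scaling of `trun` does not descend, so the converse passes through the
capacity. One nearly doubly stochastic scaling of `trun` forces positive capacity, by Hall's theorem
(`cap_pos_of_isApproxScalable`). Positive capacity of `T` yields a near-minimizer `H`; `g` is chosen
to make the first marginal equal to `Q` exactly, and a first-order perturbation of `H` inside the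
triangular group shows that the second marginal is close to `P` (`hsNorm_sub_diagonal_sq_le`). No
compactness or convergence of an iteration is needed. -/

theorem lt_conjPart_iff {lam : Fin k → ℕ} (h : Antitone lam) (c : Fin k)
    (j : Fin (Finset.univ.sup lam)) : (c : ℕ) < conjPart lam j ↔ (j : ℕ) < lam c := by
  constructor
  · intro hc
    by_contra hj
    have hsub : (Finset.univ.filter fun i => (j : ℕ) < lam i) ⊆ Finset.Iio c := by
      intro i hi
      rw [Finset.mem_filter] at hi
      rw [Finset.mem_Iio]
      by_contra hic
      exact hj (hi.2.trans_le (h (not_lt.1 hic)))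
    have := Finset.card_le_card hsub
    rw [Fin.card_Iio] at this
    exact absurd hc (not_lt.2 this)
  · intro hj
    have hsub : Finset.Iic c ⊆ (Finset.univ.filter fun i => (j : ℕ) < lam i) := by
      intro i hi
      rw [Finset.mem_Iic] at hi
      exact Finset.mem_filter.2 ⟨Finset.mem_univ _, hj.trans_le (h hi)⟩
    have := Finset.card_le_card hsub
    rw [Fin.card_Iic] at this
    exact this

theorem conjPart_pos (lam : Fin k → ℕ) (j : Fin (Finset.univ.sup lam)) : 0 < conjPart lam j := by
  obtain ⟨i, -, hi⟩ := Finset.lt_sup_iff.1 j.2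
  exact Finset.card_pos.2 ⟨i, Finset.mem_filter.2 ⟨Finset.mem_univ _, hi⟩⟩

/-- The block that contains the index `a`. -/
def blk (lam : Fin k → ℕ) (hl : ∑ i, lam i = l) (a : Fin l) : Fin (Finset.univ.sup lam) :=
  ((blockEquiv lam hl).symm a).1

/-- The second coordinate of a box of the diagram `lam`, as a row index. -/
def rowOf (lam : Fin k → ℕ) (x : Σ j : Fin (Finset.univ.sup lam), Fin (conjPart lam j)) : Fin k :=
  Fin.castLE (conjPart_le lam x.1) x.2

/-- The position of the index `a` in its block. -/
def col (lam : Fin k → ℕ) (hl : ∑ i, lam i = l) (a : Fin l) : Fin k :=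
  rowOf lam ((blockEquiv lam hl).symm a)

theorem col_lt (lam : Fin k → ℕ) (hl : ∑ i, lam i = l) (a : Fin l) :
    (col lam hl a : ℕ) < conjPart lam (blk lam hl a) :=
  ((blockEquiv lam hl).symm a).2.2

/-- The index with given block and position. -/
def idx (lam : Fin k → ℕ) (hl : ∑ i, lam i = l) (j : Fin (Finset.univ.sup lam)) (c : Fin k)
    (h : (c : ℕ) < conjPart lam j) : Fin l :=
  blockEquiv lam hl ⟨j, ⟨c, h⟩⟩

@[simp] theorem blk_idx (lam : Fin k → ℕ) (hl : ∑ i, lam i = l) (j c h) :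
    blk lam hl (idx lam hl j c h) = j := by
  simp [blk, idx]

@[simp] theorem col_idx (lam : Fin k → ℕ) (hl : ∑ i, lam i = l) (j c h) :
    col lam hl (idx lam hl j c h) = c := by
  simp only [col, idx, Equiv.symm_apply_apply]
  rfl

theorem idx_blk_col (lam : Fin k → ℕ) (hl : ∑ i, lam i = l) (a : Fin l) :
    idx lam hl (blk lam hl a) (col lam hl a) (col_lt lam hl a) = a := by
  simp only [idx, blk, col]
  exact (blockEquiv lam hl).apply_symm_apply a

theorem ext_blk_col (lam : Fin k → ℕ) (hl : ∑ i, lam i = l) {a b : Fin l}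
    (h1 : blk lam hl a = blk lam hl b) (h2 : col lam hl a = col lam hl b) : a = b := by
  rw [← idx_blk_col lam hl a, ← idx_blk_col lam hl b]
  congr 1

theorem gadget_apply (lam : Fin k → ℕ) (hl : ∑ i, lam i = l) (X : Matrix (Fin k) (Fin k) ℂ)
    (a b : Fin l) : gadget lam hl X a b =
      if blk lam hl a = blk lam hl b then X (col lam hl a) (col lam hl b) else 0 := by
  have key : ∀ x y : Σ j : Fin (Finset.univ.sup lam), Fin (conjPart lam j),
      Matrix.blockDiagonal' (fun j => corner (conjPart_le lam j) X) x y =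
        if x.1 = y.1 then X (rowOf lam x) (rowOf lam y) else 0 := by
    rintro ⟨i, r⟩ ⟨j, s⟩
    by_cases h : i = j
    · subst h
      rw [Matrix.blockDiagonal'_apply_eq, if_pos rfl]
      rfl
    · rw [Matrix.blockDiagonal'_apply_ne _ _ _ h, if_neg h]
  exact key _ _

/-- The boxes of the Young diagram in row `c` are distinguished by their column, which runs over `j
< lam c`. -/
theorem card_col_eq {lam : Fin k → ℕ} (h : Antitone lam) (hl : ∑ i, lam i = l) (c : Fin k) :
    (Finset.univ.filter fun a => col lam hl a = c).card = lam c := by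
  have h1 : (Finset.univ.filter fun a => col lam hl a = c).card =
      (Finset.univ.filter fun j : Fin (Finset.univ.sup lam) => (j : ℕ) < lam c).card := by
    refine Finset.card_bij (fun a _ => blk lam hl a) ?_ ?_ ?_
    · intro a ha
      rw [Finset.mem_filter] at ha ⊢
      refine ⟨Finset.mem_univ _, ?_⟩
      rw [← lt_conjPart_iff h, ← ha.2]
      exact col_lt lam hl a
    · intro a ha b hb hab
      rw [Finset.mem_filter] at ha hb
      exact ext_blk_col lam hl hab (ha.2.trans hb.2.symm)
    · intro j hj
      rw [Finset.mem_filter, ← lt_conjPart_iff h] at hj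
      exact ⟨idx lam hl j c hj.2, by simp, by simp⟩
  have hc : lam c ≤ Finset.univ.sup lam := Finset.le_sup (Finset.mem_univ c)
  rw [h1, ← Fintype.card_subtype]
  have e : {j : Fin (Finset.univ.sup lam) // (j : ℕ) < lam c} ≃ Fin (lam c) :=
    { toFun := fun j => ⟨j.1, j.2⟩
      invFun := fun j => ⟨⟨j, j.2.trans_le hc⟩, j.2⟩
      left_inv := fun _ => rfl
      right_inv := fun _ => rfl }
  rw [Fintype.card_congr e, Fintype.card_fin]

/-! ### Algebraic properties of the gadget -/

theorem gadget_one (lam : Fin k → ℕ) (hl : ∑ i, lam i = l) : gadget lam hl 1 = 1 := by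
  ext a b
  rw [gadget_apply, Matrix.one_apply, Matrix.one_apply]
  by_cases h : a = b
  · simp [h]
  · rw [if_neg h]
    split_ifs with h1 h2
    · exact absurd (ext_blk_col lam hl h1 h2) h
    · rfl
    · rfl

theorem gadget_conjTranspose (lam : Fin k → ℕ) (hl : ∑ i, lam i = l)
    (X : Matrix (Fin k) (Fin k) ℂ) : gadget lam hl Xᴴ = (gadget lam hl X)ᴴ := by
  ext a b
  rw [Matrix.conjTranspose_apply, gadget_apply, gadget_apply]
  by_cases h : blk lam hl a = blk lam hl b
  · simp [h]
  · rw [if_neg h, if_neg (Ne.symm h), star_zero]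

/-- The column of `U` at index `b` is supported on indices `≤ b`, so in the corner containing `b` no
summand of the full product is lost by truncation. For `U` not upper triangular the identity fails
in general. -/
theorem gadget_mul (lam : Fin k → ℕ) (hl : ∑ i, lam i = l)
    (X : Matrix (Fin k) (Fin k) ℂ) {U : Matrix (Fin k) (Fin k) ℂ} (hU : U.BlockTriangular id) :
    gadget lam hl (X * U) = gadget lam hl X * gadget lam hl U := by
  ext a b
  rw [Matrix.mul_apply, gadget_apply, Matrix.mul_apply]
  split_ifs with h
  · symm
    refine Finset.sum_bij_ne_zero (fun d _ _ => col lam hl d) ?_ ?_ ?_ ?_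
    · intros; exact Finset.mem_univ _
    · intro d _ hd d' _ hd' he
      refine ext_blk_col lam hl ?_ he
      have h1 := left_ne_zero_of_mul hd
      have h2 := left_ne_zero_of_mul hd'
      rw [gadget_apply] at h1 h2
      rw [← (ite_ne_right_iff.1 h1).1, ← (ite_ne_right_iff.1 h2).1]
    · intro c _ hc
      have hcb : c ≤ col lam hl b := by
        by_contra hlt
        exact right_ne_zero_of_mul hc (hU (not_le.1 hlt))
      have hlt : (c : ℕ) < conjPart lam (blk lam hl b) :=
        lt_of_le_of_lt hcb (col_lt lam hl b)
      refine ⟨idx lam hl (blk lam hl b) c hlt, Finset.mem_univ _, ?_, by simp⟩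
      simpa [gadget_apply, h] using hc
    · intro d _ hd
      have h1 := left_ne_zero_of_mul hd
      have h2 := right_ne_zero_of_mul hd
      rw [gadget_apply] at h1 h2
      rw [gadget_apply, gadget_apply, if_pos (ite_ne_right_iff.1 h1).1,
        if_pos (ite_ne_right_iff.1 h2).1]
  · symm
    refine Finset.sum_eq_zero fun d _ => ?_
    rw [gadget_apply, gadget_apply]
    by_cases h1 : blk lam hl a = blk lam hl d
    · rw [if_neg (c := blk lam hl d = _) (fun h2 => h (h1.trans h2)), mul_zero]
    · rw [if_neg h1, zero_mul]

theorem gadget_conj (lam : Fin k → ℕ) (hl : ∑ i, lam i = l)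
    (X : Matrix (Fin k) (Fin k) ℂ) {U : Matrix (Fin k) (Fin k) ℂ} (hU : U.BlockTriangular id) :
    gadget lam hl (Uᴴ * X * U) = (gadget lam hl U)ᴴ * gadget lam hl X * gadget lam hl U := by
  rw [gadget_mul _ _ _ hU]
  congr 1
  rw [← Matrix.conjTranspose_conjTranspose (Uᴴ * X), gadget_conjTranspose,
    Matrix.conjTranspose_mul, Matrix.conjTranspose_conjTranspose, gadget_mul _ _ _ hU,
    Matrix.conjTranspose_mul, gadget_conjTranspose, Matrix.conjTranspose_conjTranspose]

theorem det_gadget (lam : Fin k → ℕ) (hl : ∑ i, lam i = l) (X : Matrix (Fin k) (Fin k) ℂ) :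
    (gadget lam hl X).det = ∏ j, (corner (conjPart_le lam j) X).det := by
  simp only [gadget, LinearMap.coe_mk, AddHom.coe_mk, Matrix.reindex_apply]
  rw [Matrix.det_submatrix_equiv_self,
    (Matrix.blockTriangular_blockDiagonal' fun j => corner (conjPart_le lam j) X).det_fintype]
  refine Finset.prod_congr rfl fun j _ => ?_
  let e : Fin (conjPart lam j) ≃
      {x : Σ j : Fin (Finset.univ.sup lam), Fin (conjPart lam j) // x.1 = j} :=
    { toFun := fun r => ⟨⟨j, r⟩, rfl⟩
      invFun := fun x => Fin.cast (by rw [x.2]) x.1.2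
      left_inv := fun _ => rfl
      right_inv := by
        rintro ⟨⟨i, r⟩, rfl⟩
        rfl }
  rw [← Matrix.det_submatrix_equiv_self e]
  congr 1
  ext r s
  exact Matrix.blockDiagonal'_apply_eq (fun j => corner (conjPart_le lam j) X) j r s

theorem prod_col {M : Type*} [CommMonoid M] {lam : Fin k → ℕ} (h : Antitone lam)
    (hl : ∑ i, lam i = l) (f : Fin k → M) : ∏ a, f (col lam hl a) = ∏ c, f c ^ lam c := by
  rw [← Finset.prod_fiberwise Finset.univ (fun a => col lam hl a)]
  refine Finset.prod_congr rfl fun c _ => ?_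
  rw [Finset.prod_congr rfl (g := fun _ => f c), Finset.prod_const, card_col_eq h hl]
  intro a ha
  rw [(Finset.mem_filter.1 ha).2]

theorem sum_col {M : Type*} [AddCommMonoid M] {lam : Fin k → ℕ} (h : Antitone lam)
    (hl : ∑ i, lam i = l) (f : Fin k → M) : ∑ a, f (col lam hl a) = ∑ c, lam c • f c :=
  prod_col (M := Multiplicative M) h hl f

theorem gadget_apply_self (lam : Fin k → ℕ) (hl : ∑ i, lam i = l) (X : Matrix (Fin k) (Fin k) ℂ)
    (a : Fin l) : gadget lam hl X a a = X (col lam hl a) (col lam hl a) := by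
  rw [gadget_apply, if_pos rfl]

theorem trace_gadget {lam : Fin k → ℕ} (h : Antitone lam) (hl : ∑ i, lam i = l)
    (X : Matrix (Fin k) (Fin k) ℂ) : (gadget lam hl X).trace = ∑ c, lam c * X c c := by
  simp only [Matrix.trace, Matrix.diag_apply, gadget_apply_self]
  rw [sum_col h hl (fun c => X c c)]
  simp

/-- Corners of `U` are again upper triangular, and each box in row `c` contributes one factor `U c
c`. -/
theorem det_gadget_upper {lam : Fin k → ℕ} (h : Antitone lam) (hl : ∑ i, lam i = l)
    {U : Matrix (Fin k) (Fin k) ℂ} (hU : U.BlockTriangular id) :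
    (gadget lam hl U).det = ∏ c, U c c ^ lam c := by
  rw [← prod_col h hl (fun c => U c c), det_gadget,
    ← (blockEquiv lam hl).prod_comp (fun a => U (col lam hl a) (col lam hl a)),
    Fintype.prod_sigma]
  refine Finset.prod_congr rfl fun j _ => ?_
  rw [Matrix.det_of_isUpperTriangular]
  · refine Finset.prod_congr rfl fun r _ => ?_
    simp only [col, Equiv.symm_apply_apply]
    rfl
  · intro r s hrs
    exact hU (show Fin.castLE _ s < Fin.castLE _ r from hrs)

/-- Products over the columns of a Young diagram, collected by column length. -/
theorem prod_conjPart {M : Type*} [CommMonoid M] {lam : Fin k → ℕ} (h : Antitone lam)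
    (f : ℕ → M) : ∏ j, f (conjPart lam j) =
      ∏ i : Fin k, f (i + 1) ^ (lam i - if h : (i : ℕ) + 1 < k then lam ⟨i + 1, h⟩ else 0) := by
  have hlt : ∀ j : Fin (Finset.univ.sup lam), conjPart lam j - 1 < k := fun j => by
    have := conjPart_pos lam j
    have := conjPart_le lam j
    omega
  rw [← Finset.prod_fiberwise Finset.univ (fun j => (⟨conjPart lam j - 1, hlt j⟩ : Fin k))]
  refine Finset.prod_congr rfl fun i _ => ?_
  rw [Finset.prod_congr rfl (g := fun _ => f (i + 1)), Finset.prod_const]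
  · congr 1
    -- The columns of length `i + 1` are those with index in `[s, lam i)`, where `s` is the length
    -- of the next row. The value `0` past the last row makes every remaining column have full
    -- length.
    set s := if h : (i : ℕ) + 1 < k then lam ⟨i + 1, h⟩ else 0 with hs
    have hiff : ∀ j : Fin (Finset.univ.sup lam),
        (⟨conjPart lam j - 1, hlt j⟩ : Fin k) = i ↔ s ≤ j ∧ (j : ℕ) < lam i := by
      intro j
      have h1 := lt_conjPart_iff h i j
      have h2 := conjPart_pos lam j
      have h3 := conjPart_le lam j
      have h4 : conjPart lam j ≤ i + 1 ↔ s ≤ j := by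
        rw [hs]
        split_ifs with hk
        · have := lt_conjPart_iff h ⟨i + 1, hk⟩ j
          simp only at this
          omega
        · simp
          omega
      rw [Fin.ext_iff, ← h1, ← h4]
      simp only
      omega
    rw [Finset.filter_congr (fun j _ => hiff j), ← Nat.card_Ico]
    have hc : lam i ≤ Finset.univ.sup lam := Finset.le_sup (Finset.mem_univ i)
    refine Finset.card_bij (fun j _ => (j : ℕ)) ?_ ?_ ?_
    · intro j hj
      exact Finset.mem_Ico.2 (Finset.mem_filter.1 hj).2
    · intro a _ b _ hab
      exact Fin.ext hab
    · intro b hb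
      rw [Finset.mem_Ico] at hb
      exact ⟨⟨b, hb.2.trans_le hc⟩, by simp [hb], rfl⟩
  · intro j hj
    have h1 := (Finset.mem_filter.1 hj).2
    rw [Fin.ext_iff] at h1
    have h2 := conjPart_pos lam j
    simp only at h1
    congr 1
    omega

theorem sum_conjPart_apply {M : Type*} [AddCommMonoid M] {lam : Fin k → ℕ} (h : Antitone lam)
    (f : ℕ → M) : ∑ j, f (conjPart lam j) =
      ∑ i : Fin k, (lam i - if h : (i : ℕ) + 1 < k then lam ⟨i + 1, h⟩ else 0) • f (i + 1) :=
  prod_conjPart (M := Multiplicative M) h f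

theorem gap_natCast {lam : Fin k → ℕ} (h : Antitone lam) (i : Fin k) :
    gap (fun i => (lam i : ℝ)) i =
      ((lam i - if h : (i : ℕ) + 1 < k then lam ⟨i + 1, h⟩ else 0 : ℕ) : ℝ) := by
  simp only [gap]
  split_ifs with hk
  · rw [Nat.cast_sub (h (Fin.le_def.2 (Nat.le_succ _)))]
  · simp

/-- The exponent `Δ lam_j` is the multiplicity of the corner of size `j` among the blocks.
Positivity makes all corner minors real, so the real part passes through the product. -/
theorem det_gadget_re {lam : Fin k → ℕ} (h : Antitone lam) (hl : ∑ i, lam i = l)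
    {X : Matrix (Fin k) (Fin k) ℂ} (hX : X.PosSemidef) :
    (gadget lam hl X).det.re = relDet (fun i => (lam i : ℝ)) X := by
  have hre : ∀ {j : ℕ} (hj : j ≤ k), ((corner hj X).det.re : ℂ) = (corner hj X).det := by
    intro j hj
    exact (Complex.eq_re_of_ofReal_le (hX.submatrix (Fin.castLE hj)).det_nonneg).symm
  have h1 : (gadget lam hl X).det.re = ∏ j, (corner (conjPart_le lam j) X).det.re := by
    rw [det_gadget, ← Complex.ofReal_re (∏ j, _), Complex.ofReal_prod]
    simp only [hre]
  rw [h1, relDet]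
  -- `prod_conjPart` needs a function on all of `ℕ`; the value `0` beyond `k` is never reached,
  -- since columns have length at most `k`.
  have h2 := prod_conjPart h (fun j => if hj : j ≤ k then (corner hj X).det.re else 0)
  simp only [conjPart_le, dif_pos] at h2
  rw [h2]
  refine Finset.prod_congr rfl fun i _ => ?_
  rw [gap_natCast h, Real.rpow_natCast, dif_pos (Nat.succ_le_of_lt i.isLt)]

/-! ### Duality -/

theorem dual_eq_of_trace {n m : ℕ} (T : Matrix (Fin n) (Fin n) ℂ →ₗ[ℂ] Matrix (Fin m) (Fin m) ℂ)
    {Y : Matrix (Fin m) (Fin m) ℂ} {Z : Matrix (Fin n) (Fin n) ℂ}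
    (h : ∀ X, (Xᴴ * Z).trace = ((T X)ᴴ * Y).trace) : dual T Y = Z := by
  refine Matrix.ext_iff_trace_mul_left.2 fun X => ?_
  have := trace_dual T Xᴴ Y
  rw [← h, Matrix.conjTranspose_conjTranspose] at this
  exact this

theorem dual_dual {n m : ℕ} (T : Matrix (Fin n) (Fin n) ℂ →ₗ[ℂ] Matrix (Fin m) (Fin m) ℂ) :
    dual (dual T) = T := by
  ext1 X
  refine dual_eq_of_trace _ fun Y => ?_
  have := congrArg star (trace_dual T X Y)
  rw [← Matrix.trace_conjTranspose, ← Matrix.trace_conjTranspose, Matrix.conjTranspose_mul,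
    Matrix.conjTranspose_mul, Matrix.conjTranspose_conjTranspose,
    Matrix.conjTranspose_conjTranspose] at this
  exact this.symm

theorem dual_comp {n m s : ℕ} (S : Matrix (Fin m) (Fin m) ℂ →ₗ[ℂ] Matrix (Fin s) (Fin s) ℂ)
    (T : Matrix (Fin n) (Fin n) ℂ →ₗ[ℂ] Matrix (Fin m) (Fin m) ℂ) :
    dual (S ∘ₗ T) = dual T ∘ₗ dual S := by
  ext1 X
  refine dual_eq_of_trace _ fun Y => ?_
  rw [LinearMap.comp_apply, LinearMap.comp_apply, trace_dual, trace_dual]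

theorem scaling_apply {n m : ℕ} (T : Matrix (Fin n) (Fin n) ℂ →ₗ[ℂ] Matrix (Fin m) (Fin m) ℂ)
    (g : GL (Fin m) ℂ) (h : GL (Fin n) ℂ) (X : Matrix (Fin n) (Fin n) ℂ) :
    scaling T g h X = (g : Matrix (Fin m) (Fin m) ℂ)ᴴ *
    T ((h : Matrix (Fin n) (Fin n) ℂ) * X * (h : Matrix (Fin n) (Fin n) ℂ)ᴴ) *
    (g : Matrix (Fin m) (Fin m) ℂ) := rfl

theorem dual_scaling {n m : ℕ} (T : Matrix (Fin n) (Fin n) ℂ →ₗ[ℂ] Matrix (Fin m) (Fin m) ℂ)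
    (g : GL (Fin m) ℂ) (h : GL (Fin n) ℂ) : dual (scaling T g h) = scaling (dual T) h g := by
  ext1 Y
  refine dual_eq_of_trace _ fun X => ?_
  simp only [scaling_apply, Matrix.conjTranspose_mul, Matrix.conjTranspose_conjTranspose,
    Matrix.mul_assoc]
  have h1 := trace_dual T ((h : Matrix (Fin n) (Fin n) ℂ) * X * (h : Matrix (Fin n) (Fin n) ℂ)ᴴ)
    ((g : Matrix (Fin m) (Fin m) ℂ) * Y * (g : Matrix (Fin m) (Fin m) ℂ)ᴴ)
  have h2 := Matrix.trace_mul_comm (h : Matrix (Fin n) (Fin n) ℂ)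
    (Xᴴ * (h : Matrix (Fin n) (Fin n) ℂ)ᴴ *
      dual T ((g : Matrix (Fin m) (Fin m) ℂ) * Y * (g : Matrix (Fin m) (Fin m) ℂ)ᴴ))
  have h3 := Matrix.trace_mul_comm (g : Matrix (Fin m) (Fin m) ℂ)ᴴ
    ((T ((h : Matrix (Fin n) (Fin n) ℂ) * X * (h : Matrix (Fin n) (Fin n) ℂ)ᴴ))ᴴ *
      ((g : Matrix (Fin m) (Fin m) ℂ) * Y))
  simp only [Matrix.conjTranspose_mul, Matrix.conjTranspose_conjTranspose, Matrix.mul_assoc]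
    at h1 h2 h3
  rw [h3, ← h1, h2]

/-- Adjoint form of `gadget_conj`: pair both sides with `X` and move `U` across the trace. -/
theorem dual_gadget_conj (lam : Fin k → ℕ) (hl : ∑ i, lam i = l) (Y : Matrix (Fin l) (Fin l) ℂ)
    {U : Matrix (Fin k) (Fin k) ℂ} (hU : U.BlockTriangular id) :
    dual (gadget lam hl) (gadget lam hl U * Y * (gadget lam hl U)ᴴ) =
      U * dual (gadget lam hl) Y * Uᴴ := by
  refine dual_eq_of_trace _ fun X => ?_
  have h1 := trace_dual (gadget lam hl) (Uᴴ * X * U) Y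
  rw [gadget_conj _ _ _ hU] at h1
  have h2 := Matrix.trace_mul_comm Uᴴ (Xᴴ * U * dual (gadget lam hl) Y)
  have h3 := Matrix.trace_mul_comm (gadget lam hl U)ᴴ
    ((gadget lam hl X)ᴴ * (gadget lam hl U) * Y)
  simp only [Matrix.conjTranspose_mul, Matrix.conjTranspose_conjTranspose, Matrix.mul_assoc]
    at h1 h2 h3 ⊢
  rw [← h3, ← h1, h2]

/-- The trace of `gadget X` counts the diagonal entry `X c c` once for every box in row `c`. -/
theorem dual_gadget_one {lam : Fin k → ℕ} (h : Antitone lam) (hl : ∑ i, lam i = l) :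
    dual (gadget lam hl) 1 = Matrix.diagonal fun i => (lam i : ℂ) := by
  refine dual_eq_of_trace _ fun X => ?_
  rw [← gadget_conjTranspose, mul_one, trace_gadget h, Matrix.trace]
  simp [Matrix.mul_diagonal, mul_comm]

/-- The adjoint of a unital map preserves the trace. -/
theorem trace_dual_gadget (lam : Fin k → ℕ) (hl : ∑ i, lam i = l) (Y : Matrix (Fin l) (Fin l) ℂ) :
    (dual (gadget lam hl) Y).trace = Y.trace := by
  have := trace_dual (gadget lam hl) 1 Y
  simpa [gadget_one] using this


/-! ### Complete positivity -/

section CompletelyPositive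

variable {n m s : ℕ}

theorem exists_isKraus_reindex {ι : Type*} [Fintype ι]
    {T : Matrix (Fin n) (Fin n) ℂ →ₗ[ℂ] Matrix (Fin m) (Fin m) ℂ}
    (A : ι → Matrix (Fin m) (Fin n) ℂ) (h : ∀ X, T X = ∑ i, A i * X * (A i)ᴴ) :
    IsKraus T fun i => A ((Fintype.equivFin ι).symm i) := by
  intro X
  rw [h, ← (Fintype.equivFin ι).symm.sum_comp]

theorem IsCompletelyPositive.of_sum {ι : Type*} [Fintype ι]
    {T : Matrix (Fin n) (Fin n) ℂ →ₗ[ℂ] Matrix (Fin m) (Fin m) ℂ}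
    (A : ι → Matrix (Fin m) (Fin n) ℂ) (h : ∀ X, T X = ∑ i, A i * X * (A i)ᴴ) :
    IsCompletelyPositive T :=
  ⟨_, _, exists_isKraus_reindex A h⟩

theorem isIndependent_iff_of_sum {ι : Type*} [Fintype ι]
    {T : Matrix (Fin n) (Fin n) ℂ →ₗ[ℂ] Matrix (Fin m) (Fin m) ℂ}
    (A : ι → Matrix (Fin m) (Fin n) ℂ) (h : ∀ X, T X = ∑ i, A i * X * (A i)ᴴ)
    (L : Submodule ℂ (Fin m → ℂ)) (R : Submodule ℂ (Fin n → ℂ)) :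
    IsIndependent T L R ↔ ∀ i, ∀ x ∈ L, ∀ y ∈ R, star x ⬝ᵥ (A i *ᵥ y) = 0 := by
  rw [(exists_isKraus_reindex A h).isIndependent_iff]
  exact (Fintype.equivFin ι).symm.forall_congr_left.trans (by simp)

theorem IsCompletelyPositive.dual {T : Matrix (Fin n) (Fin n) ℂ →ₗ[ℂ] Matrix (Fin m) (Fin m) ℂ}
    (hT : IsCompletelyPositive T) : IsCompletelyPositive (dual T) := by
  obtain ⟨r, A, hA⟩ := hT
  exact ⟨r, fun i => (A i)ᴴ, fun X => by simp [hA.dual X]⟩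

theorem IsKraus.comp_sum {r t : ℕ}
    {S : Matrix (Fin m) (Fin m) ℂ →ₗ[ℂ] Matrix (Fin s) (Fin s) ℂ}
    {T : Matrix (Fin n) (Fin n) ℂ →ₗ[ℂ] Matrix (Fin m) (Fin m) ℂ}
    {A : Fin r → Matrix (Fin s) (Fin m) ℂ} {B : Fin t → Matrix (Fin m) (Fin n) ℂ}
    (hA : IsKraus S A) (hB : IsKraus T B) (X : Matrix (Fin n) (Fin n) ℂ) :
    (S ∘ₗ T) X = ∑ i : Fin r × Fin t, (A i.1 * B i.2) * X * (A i.1 * B i.2)ᴴ := by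
  rw [LinearMap.comp_apply, hA, Fintype.sum_prod_type]
  refine Finset.sum_congr rfl fun i _ => ?_
  rw [hB, Matrix.mul_sum, Matrix.sum_mul]
  refine Finset.sum_congr rfl fun j _ => ?_
  simp only [Matrix.conjTranspose_mul, Matrix.mul_assoc]

theorem IsCompletelyPositive.comp {S : Matrix (Fin m) (Fin m) ℂ →ₗ[ℂ] Matrix (Fin s) (Fin s) ℂ}
    {T : Matrix (Fin n) (Fin n) ℂ →ₗ[ℂ] Matrix (Fin m) (Fin m) ℂ}
    (hS : IsCompletelyPositive S) (hT : IsCompletelyPositive T) :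
    IsCompletelyPositive (S ∘ₗ T) := by
  obtain ⟨r, A, hA⟩ := hS
  obtain ⟨t, B, hB⟩ := hT
  exact .of_sum _ (hA.comp_sum hB)

theorem IsCompletelyPositive.scaling
    {T : Matrix (Fin n) (Fin n) ℂ →ₗ[ℂ] Matrix (Fin m) (Fin m) ℂ} (hT : IsCompletelyPositive T)
    (g : GL (Fin m) ℂ) (h : GL (Fin n) ℂ) : IsCompletelyPositive (scaling T g h) := by
  obtain ⟨r, A, hA⟩ := hT
  refine ⟨r, fun i => (g : Matrix (Fin m) (Fin m) ℂ)ᴴ * A i * (h : Matrix (Fin n) (Fin n) ℂ),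
    fun X => ?_⟩
  rw [scaling_apply, hA, Finset.mul_sum, Finset.sum_mul]
  refine Finset.sum_congr rfl fun i _ => ?_
  simp only [Matrix.conjTranspose_mul, Matrix.conjTranspose_conjTranspose, Matrix.mul_assoc]

theorem IsCompletelyPositive.posSemidef
    {T : Matrix (Fin n) (Fin n) ℂ →ₗ[ℂ] Matrix (Fin m) (Fin m) ℂ} (hT : IsCompletelyPositive T)
    {X : Matrix (Fin n) (Fin n) ℂ} (hX : X.PosSemidef) : (T X).PosSemidef := by
  obtain ⟨r, A, hA⟩ := hT
  rw [hA]
  exact Matrix.posSemidef_sum _ fun i _ => hX.mul_mul_conjTranspose_same (A i)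

end CompletelyPositive

/-! ### Kraus operators of the gadget and complete positivity of the reduction -/

section GadgetKraus

variable {k l : ℕ}

/-- The Kraus operators of the gadget: the inclusions of the blocks. -/
def blockIncl (lam : Fin k → ℕ) (hl : ∑ i, lam i = l) (j : Fin (Finset.univ.sup lam)) :
    Matrix (Fin l) (Fin k) ℂ :=
  Matrix.of fun a c => if blk lam hl a = j ∧ col lam hl a = c then 1 else 0

theorem gadget_isKraus (lam : Fin k → ℕ) (hl : ∑ i, lam i = l) :
    IsKraus (gadget lam hl) (blockIncl lam hl) := by
  intro X
  ext a b
  rw [gadget_apply, Matrix.sum_apply]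
  simp only [Matrix.mul_apply, Matrix.conjTranspose_apply, blockIncl, Matrix.of_apply, ite_and]
  by_cases h : blk lam hl a = blk lam hl b <;> simp [apply_ite, h]

theorem blockIncl_conjTranspose_mulVec (lam : Fin k → ℕ) (hl : ∑ i, lam i = l)
    (j : Fin (Finset.univ.sup lam)) (x : Fin l → ℂ) (c : Fin k) :
    ((blockIncl lam hl j)ᴴ *ᵥ x) c =
      if h : (c : ℕ) < conjPart lam j then x (idx lam hl j c h) else 0 := by
  simp only [Matrix.mulVec, dotProduct, Matrix.conjTranspose_apply, blockIncl, Matrix.of_apply]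
  split_ifs with h
  · rw [Finset.sum_eq_single (idx lam hl j c h)]
    · simp
    · intro b _ hb
      rw [if_neg, star_zero, zero_mul]
      rintro ⟨h1, h2⟩
      exact hb (ext_blk_col lam hl (by simpa using h1) (by simpa using h2))
    · simp
  · refine Finset.sum_eq_zero fun a _ => ?_
    rw [if_neg, star_zero, zero_mul]
    rintro ⟨rfl, rfl⟩
    exact h (col_lt lam hl a)

theorem gadget_isCompletelyPositive (lam : Fin k → ℕ) (hl : ∑ i, lam i = l) :
    IsCompletelyPositive (gadget lam hl) :=
  ⟨_, _, gadget_isKraus lam hl⟩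

end GadgetKraus

theorem trun_isCompletelyPositive {n m N : ℕ} (p : Fin n → ℕ) (q : Fin m → ℕ)
    (hp : ∑ i, p i = N) (hq : ∑ i, q i = N)
    {T : Matrix (Fin n) (Fin n) ℂ →ₗ[ℂ] Matrix (Fin m) (Fin m) ℂ} (hT : IsCompletelyPositive T) :
    IsCompletelyPositive (trun p q hp hq T) :=
  (gadget_isCompletelyPositive q hq).comp (hT.comp (gadget_isCompletelyPositive p hp).dual)

/-! ### Positive matrices -/

section Positive

variable {k : ℕ}

theorem posSemidef_det_re_nonneg {A : Matrix (Fin k) (Fin k) ℂ} (hA : A.PosSemidef) :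
    0 ≤ A.det.re :=
  (Complex.le_def.1 hA.det_nonneg).1

theorem posDef_det_re_pos {A : Matrix (Fin k) (Fin k) ℂ} (hA : A.PosDef) : 0 < A.det.re :=
  (Complex.lt_def.1 hA.det_pos).1

/-- The inequality `x ≤ exp (x - 1)` multiplied over the eigenvalues. It serves as the
arithmetic-geometric mean inequality: trace `k` forces determinant at most `1`. -/
theorem det_re_le_exp {A : Matrix (Fin k) (Fin k) ℂ} (hA : A.PosSemidef) :
    A.det.re ≤ Real.exp (A.trace.re - k) := by
  have h1 : A.det.re = ∏ i, hA.1.eigenvalues i := by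
    rw [hA.1.det_eq_prod_eigenvalues]
    exact_mod_cast Complex.ofReal_re _
  have h2 : A.trace.re = ∑ i, hA.1.eigenvalues i := by
    rw [hA.1.trace_eq_sum_eigenvalues]
    exact_mod_cast Complex.ofReal_re _
  have h3 : A.trace.re - k = ∑ i, (hA.1.eigenvalues i - 1) := by
    rw [h2, Finset.sum_sub_distrib]
    simp
  rw [h1, h3, Real.exp_sum]
  refine Finset.prod_le_prod (fun i _ => hA.eigenvalues_nonneg i) fun i _ => ?_
  linarith [Real.add_one_le_exp (hA.1.eigenvalues i - 1)]

theorem det_conj_re (A B : Matrix (Fin k) (Fin k) ℂ) :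
    (Bᴴ * A * B).det.re = Complex.normSq B.det * A.det.re := by
  rw [Matrix.det_mul, Matrix.det_mul, Matrix.det_conjTranspose, mul_right_comm]
  rw [show star B.det * B.det = (Complex.normSq B.det : ℂ) from
    (Complex.normSq_eq_conj_mul_self).symm, Complex.re_ofReal_mul]

theorem det_conj_re' (A B : Matrix (Fin k) (Fin k) ℂ) :
    (B * A * Bᴴ).det.re = Complex.normSq B.det * A.det.re := by
  have := det_conj_re A Bᴴ
  rwa [Matrix.conjTranspose_conjTranspose, Matrix.det_conjTranspose,
    show star B.det = (starRingEnd ℂ) B.det from rfl, Complex.normSq_conj] at this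

theorem upper_inv {U : Matrix (Fin k) (Fin k) ℂ} (hU : U.BlockTriangular id) (hd : U.det ≠ 0) :
    U⁻¹.BlockTriangular id := by
  have := Matrix.invertibleOfIsUnitDet U (isUnit_iff_ne_zero.2 hd)
  exact Matrix.blockTriangular_inv_of_blockTriangular hU

/-- Every positive definite matrix is `U Uᴴ` for an invertible upper triangular `U`. -/
theorem exists_upper_mul_conjTranspose {S : Matrix (Fin k) (Fin k) ℂ} (hS : S.PosDef) :
    ∃ U : Matrix (Fin k) (Fin k) ℂ, U.BlockTriangular id ∧ U.det ≠ 0 ∧ U * Uᴴ = S := by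
  -- The LDL decomposition yields a lower triangular factor; reversing the order of the basis turns
  -- it into an upper triangular one.
  have hS' : (S.submatrix Fin.rev Fin.rev).PosDef := hS.submatrix Fin.rev_injective
  set L := LDL.lowerInv hS' with hL
  set U := L.submatrix Fin.rev Fin.rev with hUdef
  have hU : U.BlockTriangular id := by
    intro i j hij
    exact LDL.lowerInv_triangular hS' (Fin.rev_lt_rev.2 hij)
  have hLd : L.det ≠ 0 := (Matrix.isUnit_det_of_invertible L).ne_zero
  have hUd : U.det ≠ 0 := by
    rw [hUdef, show (Fin.rev : Fin k → Fin k) = Fin.revPerm from rfl,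
      Matrix.det_submatrix_equiv_self]
    exact hLd
  set d : Fin k → ℂ := fun i => LDL.diagEntries hS' (Fin.rev i) with hd
  have hD : U * S * Uᴴ = Matrix.diagonal d := by
    have h1 := LDL.diag_eq_lowerInv_conj hS'
    have h2 := congrArg (fun M => M.submatrix Fin.revPerm Fin.revPerm) h1
    simp only [LDL.diag, Matrix.submatrix_diagonal_equiv] at h2
    rw [← Matrix.submatrix_mul_equiv _ _ _ Fin.revPerm _,
      ← Matrix.submatrix_mul_equiv _ _ _ Fin.revPerm _] at h2
    have h3 : (S.submatrix Fin.rev Fin.rev).submatrix Fin.revPerm Fin.revPerm = S := by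
      ext i j
      simp
    rw [h3] at h2
    exact h2.symm
  have hpd : (Matrix.diagonal d).PosDef := by
    rw [← hD]
    have := hS.mul_mul_conjTranspose_same (B := U)
      (Matrix.vecMul_injective_of_isUnit (Matrix.isUnit_iff_isUnit_det U |>.2
        (isUnit_iff_ne_zero.2 hUd)))
    exact this
  have hdpos : ∀ i, 0 < d i := fun i => Matrix.posDef_diagonal_iff.1 hpd i
  set e : Fin k → ℂ := fun i => (Real.sqrt (d i).re : ℂ) with he
  have hed : ∀ i, e i * e i = d i := by
    intro i
    have h1 := Complex.lt_def.1 (hdpos i)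
    rw [he]
    simp only
    rw [← Complex.ofReal_mul, Real.mul_self_sqrt h1.1.le]
    exact Complex.ext rfl h1.2
  have hestar : (Matrix.diagonal e)ᴴ = Matrix.diagonal e := by
    rw [Matrix.diagonal_conjTranspose]
    congr 1
    ext i
    simp [he]
  have hUu : IsUnit U.det := isUnit_iff_ne_zero.2 hUd
  refine ⟨U⁻¹ * Matrix.diagonal e, (upper_inv hU hUd).mul (Matrix.blockTriangular_diagonal e),
    ?_, ?_⟩
  · rw [Matrix.det_mul, Matrix.det_diagonal]
    refine mul_ne_zero ?_ (Finset.prod_ne_zero_iff.2 fun i _ hi => (hdpos i).ne' ?_)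
    · exact ((Matrix.isUnit_nonsing_inv_det_iff).2 hUu).ne_zero
    · rw [← hed, hi, zero_mul]
  · rw [Matrix.conjTranspose_mul, hestar, Matrix.mul_assoc, ← Matrix.mul_assoc (Matrix.diagonal e),
      Matrix.diagonal_mul_diagonal]
    simp only [hed]
    rw [← hD, Matrix.conjTranspose_nonsing_inv]
    have hUu' : IsUnit Uᴴ.det := by
      rw [Matrix.det_conjTranspose]
      exact hUu.star
    rw [Matrix.mul_assoc _ Uᴴ, Matrix.mul_nonsing_inv _ hUu', Matrix.mul_one, ← Matrix.mul_assoc,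
      Matrix.nonsing_inv_mul _ hUu, Matrix.one_mul]

end Positive


/-! ### The capacity of the reduction -/

section Capacity

variable {k l : ℕ}

theorem gadget_mul_gadget_inv (lam : Fin k → ℕ) (hl : ∑ i, lam i = l)
    {U : Matrix (Fin k) (Fin k) ℂ} (hU : U.BlockTriangular id) (hd : U.det ≠ 0) :
    gadget lam hl U * gadget lam hl U⁻¹ = 1 := by
  rw [← gadget_mul _ _ _ (upper_inv hU hd),
    Matrix.mul_nonsing_inv _ (isUnit_iff_ne_zero.2 hd), gadget_one]

theorem det_gadget_upper_ne_zero (lam : Fin k → ℕ) (hl : ∑ i, lam i = l)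
    {U : Matrix (Fin k) (Fin k) ℂ} (hU : U.BlockTriangular id) (hd : U.det ≠ 0) :
    (gadget lam hl U).det ≠ 0 := by
  have := congrArg Matrix.det (gadget_mul_gadget_inv lam hl hU hd)
  rw [Matrix.det_mul, Matrix.det_one] at this
  exact left_ne_zero_of_mul (this.trans_ne one_ne_zero)

theorem relDet_conjTranspose_mul_self {lam : Fin k → ℕ} (h : Antitone lam)
    (hl : ∑ i, lam i = l) {U : Matrix (Fin k) (Fin k) ℂ} (hU : U.BlockTriangular id) :
    relDet (fun i => (lam i : ℝ)) (Uᴴ * U) = Complex.normSq (gadget lam hl U).det := by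
  rw [← det_gadget_re h hl (Matrix.posSemidef_conjTranspose_mul_self U)]
  have := gadget_conj lam hl 1 hU
  rw [Matrix.mul_one] at this
  rw [this, det_conj_re, gadget_one, Matrix.det_one, Complex.one_re, mul_one]

theorem dual_gadget_mul_conjTranspose {lam : Fin k → ℕ} (h : Antitone lam)
    (hl : ∑ i, lam i = l) {U : Matrix (Fin k) (Fin k) ℂ} (hU : U.BlockTriangular id) :
    dual (gadget lam hl) (gadget lam hl U * (gadget lam hl U)ᴴ) =
      U * Matrix.diagonal (fun i => (lam i : ℂ)) * Uᴴ := by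
  have := dual_gadget_conj lam hl 1 hU
  rwa [Matrix.mul_one, dual_gadget_one h] at this

/-- Among the matrices with a given image under the adjoint of the gadget, the block
diagonal one built from the upper triangular factor has the largest determinant. -/
theorem det_le_of_dual_gadget_eq {lam : Fin k → ℕ} (hl : ∑ i, lam i = l)
    {X : Matrix (Fin l) (Fin l) ℂ} (hX : X.PosSemidef) {U : Matrix (Fin k) (Fin k) ℂ}
    (hU : U.BlockTriangular id) (hd : U.det ≠ 0)
    (hXU : dual (gadget lam hl) X = U * Matrix.diagonal (fun i => (lam i : ℂ)) * Uᴴ) :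
    X.det.re ≤ Complex.normSq (gadget lam hl U).det := by
  -- Conjugation by `gadget U⁻¹` reduces to the image `diag lam`, whose trace is `l`; the conjugated
  -- matrix then has trace `l` and so determinant at most `1`.
  set K := gadget lam hl U⁻¹ with hK
  have hUi := upper_inv hU hd
  have h1 : dual (gadget lam hl) (K * X * Kᴴ) = Matrix.diagonal (fun i => (lam i : ℂ)) := by
    rw [hK, dual_gadget_conj _ _ _ hUi, hXU, Matrix.conjTranspose_nonsing_inv]
    have hu : IsUnit U.det := isUnit_iff_ne_zero.2 hd
    have hu' : IsUnit Uᴴ.det := by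
      rw [Matrix.det_conjTranspose]
      exact hu.star
    rw [Matrix.mul_assoc, Matrix.mul_assoc _ Uᴴ, Matrix.mul_nonsing_inv _ hu', Matrix.mul_one,
      ← Matrix.mul_assoc, Matrix.nonsing_inv_mul _ hu, Matrix.one_mul]
  have h2 : (K * X * Kᴴ).trace = l := by
    rw [← trace_dual_gadget lam hl, h1, Matrix.trace_diagonal, ← hl]
    simp
  have h3 := det_re_le_exp (hX.mul_mul_conjTranspose_same K)
  rw [h2, Complex.natCast_re, sub_self, Real.exp_zero, det_conj_re'] at h3
  have h4 := congrArg Complex.normSq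
    (congrArg Matrix.det (gadget_mul_gadget_inv lam hl hU hd))
  rw [Matrix.det_mul, Complex.normSq_mul, Matrix.det_one, Complex.normSq_one] at h4
  calc X.det.re = Complex.normSq (gadget lam hl U).det * (Complex.normSq K.det * X.det.re) := by
        rw [← mul_assoc, h4, one_mul]
    _ ≤ Complex.normSq (gadget lam hl U).det * 1 :=
        mul_le_mul_of_nonneg_left h3 (Complex.normSq_nonneg _)
    _ = _ := mul_one _

/-- The coordinate projection onto the zeros of `lam`. -/
def zeroProj (lam : Fin k → ℕ) : Matrix (Fin k) (Fin k) ℂ :=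
  Matrix.diagonal fun i => if lam i = 0 then 1 else 0

theorem blockIncl_mul_zeroProj {lam : Fin k → ℕ} (h : Antitone lam) (hl : ∑ i, lam i = l)
    (j : Fin (Finset.univ.sup lam)) : blockIncl lam hl j * zeroProj lam = 0 := by
  ext a c
  simp only [zeroProj, Matrix.mul_diagonal, blockIncl, Matrix.of_apply, Matrix.zero_apply]
  split_ifs with h1 h2
  · obtain ⟨rfl, rfl⟩ := h1
    have := (lt_conjPart_iff h _ _).1 (col_lt lam hl a)
    omega
  all_goals simp

/-- For `X ≻ 0` the kernel of the image under the adjoint consists of the vectors supported on the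
zero parts of `lam`. The projection fills this kernel, so that a triangular factorization becomes
available. -/
theorem dual_gadget_add_zeroProj_posDef {lam : Fin k → ℕ} (h : Antitone lam)
    (hl : ∑ i, lam i = l) {X : Matrix (Fin l) (Fin l) ℂ} (hX : X.PosDef) :
    (dual (gadget lam hl) X + zeroProj lam).PosDef := by
  have hZ : (dual (gadget lam hl) X).PosSemidef :=
    (gadget_isCompletelyPositive lam hl).dual.posSemidef hX.posSemidef
  have hD : (zeroProj lam).PosSemidef := by
    refine Matrix.PosSemidef.diagonal fun i => ?_
    simp only [Pi.zero_apply]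
    split_ifs <;> simp
  refine Matrix.PosDef.of_dotProduct_mulVec_pos (hZ.add hD).1 fun {x} hx => ?_
  rw [Matrix.add_mulVec, dotProduct_add]
  obtain ⟨c, hc⟩ := Function.ne_iff.1 hx
  by_cases hlam : lam c = 0
  · refine add_pos_of_nonneg_of_pos (hZ.dotProduct_mulVec_nonneg x) ?_
    simp only [dotProduct, zeroProj, Matrix.mulVec_diagonal]
    refine Finset.sum_pos' (fun i _ => ?_) ⟨c, Finset.mem_univ _, ?_⟩
    · split_ifs
      · rw [one_mul]
        exact star_mul_self_nonneg _
      · simp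
    · rw [if_pos hlam, one_mul]
      exact star_mul_self_pos (IsRegular.of_ne_zero hc)
  · refine add_pos_of_pos_of_nonneg ?_ (hD.dotProduct_mulVec_nonneg x)
    rw [(gadget_isKraus lam hl).dual, Matrix.sum_mulVec, dotProduct_sum]
    have hj : ∀ j, star x ⬝ᵥ ((blockIncl lam hl j)ᴴ * X * blockIncl lam hl j) *ᵥ x =
        star (blockIncl lam hl j *ᵥ x) ⬝ᵥ X *ᵥ (blockIncl lam hl j *ᵥ x) := by
      intro j
      rw [← Matrix.mulVec_mulVec, ← Matrix.mulVec_mulVec, Matrix.star_mulVec,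
        ← Matrix.dotProduct_mulVec]
    simp only [hj]
    have hc0 : 0 < lam c := Nat.pos_of_ne_zero hlam
    -- The first column of the diagram contains every row of positive length, in particular row `c`.
    let j : Fin (Finset.univ.sup lam) :=
      ⟨0, hc0.trans_le (Finset.le_sup (f := lam) (Finset.mem_univ c))⟩
    refine Finset.sum_pos' (fun i _ => hX.posSemidef.dotProduct_mulVec_nonneg _)
      ⟨j, Finset.mem_univ _, hX.dotProduct_mulVec_pos ?_⟩
    have hcj : (c : ℕ) < conjPart lam j := (lt_conjPart_iff h c j).2 hc0
    refine Function.ne_iff.2 ⟨idx lam hl j c hcj, ?_⟩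
    simpa [Matrix.mulVec, dotProduct, blockIncl] using hc

/-- The zero parts of `lam` are its last indices, so an entry from a nonzero part into a zero part
lies below the diagonal. -/
theorem zeroProj_mul_upper_mul {lam : Fin k → ℕ} (h : Antitone lam)
    {U : Matrix (Fin k) (Fin k) ℂ} (hU : U.BlockTriangular id) :
    zeroProj lam * U * (1 - zeroProj lam) = 0 := by
  rw [Matrix.mul_sub, Matrix.mul_one, sub_eq_zero]
  ext a b
  simp only [zeroProj, Matrix.mul_diagonal, Matrix.diagonal_mul]
  by_cases ha : lam a = 0 <;> by_cases hb : lam b = 0 <;> simp [ha, hb]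
  refine hU (show b < a from ?_)
  by_contra hab
  have := h (not_lt.1 hab)
  omega

/-- If all parts are positive this is the triangular factorization rescaled by `lam^(-1/2)`. In
general, with `D` the projection onto the zero parts, factor `Z + D = U Uᴴ`; then `U` commutes with
`D`, and removing `D` leaves `Z = U (1 - D) Uᴴ`. -/
theorem exists_upper_dual_gadget_eq {lam : Fin k → ℕ} (h : Antitone lam)
    (hl : ∑ i, lam i = l) {X : Matrix (Fin l) (Fin l) ℂ} (hX : X.PosDef) :
    ∃ U : Matrix (Fin k) (Fin k) ℂ, U.BlockTriangular id ∧ U.det ≠ 0 ∧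
      dual (gadget lam hl) X = U * Matrix.diagonal (fun i => (lam i : ℂ)) * Uᴴ := by
  obtain ⟨U, hU, hd, hUU⟩ :=
    exists_upper_mul_conjTranspose (dual_gadget_add_zeroProj_posDef h hl hX)
  set Z := dual (gadget lam hl) X with hZ
  set D := zeroProj lam with hDdef
  have hDD : D * D = D := by
    rw [hDdef, zeroProj, Matrix.diagonal_mul_diagonal]
    congr 1
    ext i
    split_ifs <;> simp
  have hDH : Dᴴ = D := by
    rw [hDdef, zeroProj, Matrix.diagonal_conjTranspose]
    congr 1
    ext i
    simp only [Pi.star_apply]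
    split_ifs <;> simp
  have hZD : Z * D = 0 := by
    rw [hZ, (gadget_isKraus lam hl).dual, Matrix.sum_mul]
    refine Finset.sum_eq_zero fun j _ => ?_
    rw [Matrix.mul_assoc, blockIncl_mul_zeroProj h, Matrix.mul_zero]
  have hDZ : D * Z = 0 := by
    have hZH : Zᴴ = Z :=
      ((gadget_isCompletelyPositive lam hl).dual.posSemidef hX.posSemidef).1
    have := congrArg Matrix.conjTranspose hZD
    rwa [Matrix.conjTranspose_mul, hDH, hZH, Matrix.conjTranspose_zero] at this
  have hu : IsUnit U.det := isUnit_iff_ne_zero.2 hd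
  have h1 : D * U = D * U * D := by
    have := zeroProj_mul_upper_mul h hU
    rwa [Matrix.mul_sub, Matrix.mul_one, sub_eq_zero] at this
  have h2 : D * U⁻¹ = D * U⁻¹ * D := by
    have := zeroProj_mul_upper_mul h (upper_inv hU hd)
    rwa [Matrix.mul_sub, Matrix.mul_one, sub_eq_zero] at this
  have h3 : D * U * Uᴴ = D := by
    rw [Matrix.mul_assoc, hUU, Matrix.mul_add, hDZ, hDD, zero_add]
  -- From `D U Uᴴ = D` one gets `D Uᴴ = D U⁻¹ D`, which absorbs `D` on the right. Together with `h1`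
  -- this gives the commutation `h5`.
  have h4 : D * Uᴴ = D * Uᴴ * D := by
    have e1 : D * U⁻¹ * (D * U * Uᴴ) = D * Uᴴ := by
      rw [← Matrix.mul_assoc, ← Matrix.mul_assoc, ← h2, Matrix.mul_assoc D,
        Matrix.nonsing_inv_mul _ hu, Matrix.mul_one]
    rw [h3] at e1
    rw [← e1, Matrix.mul_assoc, Matrix.mul_assoc, Matrix.mul_assoc, hDD]
  have h5 : U * D = D * U := by
    have := congrArg Matrix.conjTranspose h4
    simp only [Matrix.conjTranspose_mul, Matrix.conjTranspose_conjTranspose, hDH] at this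
    rw [this, ← Matrix.mul_assoc, ← h1]
  have h6 : U * (1 - D) * Uᴴ = Z := by
    rw [Matrix.mul_sub, Matrix.mul_one, Matrix.sub_mul, h5, h3, hUU, add_sub_cancel_right]
  -- The value `1` at the zero parts only keeps the factor invertible; there `diag lam` vanishes
  -- anyway.
  set e : Fin k → ℂ := fun i => if lam i = 0 then 1 else (1 / Real.sqrt (lam i) : ℝ) with he
  have hestar : (Matrix.diagonal e)ᴴ = Matrix.diagonal e := by
    rw [Matrix.diagonal_conjTranspose]
    congr 1
    ext i
    simp only [he, Pi.star_apply]
    split_ifs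
    · simp
    · exact Complex.conj_ofReal _
  refine ⟨U * Matrix.diagonal e, hU.mul (Matrix.blockTriangular_diagonal e), ?_, ?_⟩
  · rw [Matrix.det_mul, Matrix.det_diagonal]
    refine mul_ne_zero hd (Finset.prod_ne_zero_iff.2 fun i _ => ?_)
    simp only [he]
    split_ifs with hi
    · exact one_ne_zero
    · have : (0 : ℝ) < lam i := by exact_mod_cast Nat.pos_of_ne_zero hi
      exact_mod_cast (one_div_pos.2 (Real.sqrt_pos.2 this)).ne'
  · rw [← h6, Matrix.conjTranspose_mul, hestar, Matrix.mul_assoc, Matrix.mul_assoc,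
      Matrix.mul_assoc, ← Matrix.mul_assoc (Matrix.diagonal e),
      ← Matrix.mul_assoc (Matrix.diagonal e * _), Matrix.diagonal_mul_diagonal,
      Matrix.diagonal_mul_diagonal]
    congr 2
    rw [hDdef, zeroProj, ← Matrix.diagonal_one, Matrix.diagonal_sub]
    congr 1
    ext i
    simp only [he]
    split_ifs with hi
    · simp [hi]
    · have : (0 : ℝ) < lam i := by exact_mod_cast Nat.pos_of_ne_zero hi
      have h7 := Real.mul_self_sqrt this.le
      have h8 := (Real.sqrt_pos.2 this).ne'
      rw [sub_zero, show ((lam i : ℂ)) = ((lam i : ℝ) : ℂ) by simp, ← Complex.ofReal_mul,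
        ← Complex.ofReal_mul, ← Complex.ofReal_one]
      congr 1
      field_simp
      exact (sq _).trans h7

end Capacity

section CapacityReduction

variable {n m N : ℕ} {p : Fin n → ℕ} {q : Fin m → ℕ}

/-- The element of `upperGL` given by an upper triangular matrix of nonzero determinant. -/
def toUpperGL {k : ℕ} (U : Matrix (Fin k) (Fin k) ℂ) (hU : U.BlockTriangular id)
    (hd : U.det ≠ 0) : upperGL k :=
  ⟨Matrix.GeneralLinearGroup.mkOfDetNeZero U hd, hU⟩

theorem GL_det_ne_zero {k : ℕ} (g : GL (Fin k) ℂ) : (g : Matrix (Fin k) (Fin k) ℂ).det ≠ 0 :=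
  ((Matrix.isUnit_iff_isUnit_det _).1 g.isUnit).ne_zero

theorem posSemidef_conj_diagonal (p : Fin n → ℕ) (U : Matrix (Fin n) (Fin n) ℂ) :
    (U * Matrix.diagonal (fun i => (p i : ℂ)) * Uᴴ).PosSemidef :=
  (Matrix.PosSemidef.diagonal fun i => by simp).mul_mul_conjTranspose_same U

theorem relDet_map_eq_det_trun (hp : Antitone p) (hq : Antitone q)
    (hpN : ∑ i, p i = N) (hqN : ∑ i, q i = N)
    {T : Matrix (Fin n) (Fin n) ℂ →ₗ[ℂ] Matrix (Fin m) (Fin m) ℂ} (hT : IsCompletelyPositive T)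
    {U : Matrix (Fin n) (Fin n) ℂ} (hU : U.BlockTriangular id) :
    relDet (fun j => (q j : ℝ)) (T (U * Matrix.diagonal (fun i => (p i : ℂ)) * Uᴴ)) =
      (trun p q hpN hqN T (gadget p hpN U * (gadget p hpN U)ᴴ)).det.re := by
  rw [← det_gadget_re hq hqN (hT.posSemidef (posSemidef_conj_diagonal p U)),
    ← dual_gadget_mul_conjTranspose hp hpN hU]
  rfl

theorem cap_trun_eq_capRel (hp : Antitone p) (hq : Antitone q)
    (hpN : ∑ i, p i = N) (hqN : ∑ i, q i = N)
    {T : Matrix (Fin n) (Fin n) ℂ →ₗ[ℂ] Matrix (Fin m) (Fin m) ℂ} (hT : IsCompletelyPositive T) :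
    cap (trun p q hpN hqN T) = capRel T (fun i => (p i : ℝ)) (fun j => (q j : ℝ)) := by
  have htrun := trun_isCompletelyPositive p q hpN hqN hT
  have : Nonempty (upperGL n) := ⟨toUpperGL 1 Matrix.blockTriangular_one (by simp)⟩
  have : Nonempty {X : Matrix (Fin N) (Fin N) ℂ // X.PosDef} := ⟨⟨1, Matrix.PosDef.one⟩⟩
  simp only [cap, capRel, Complex.ofReal_natCast]
  refine le_antisymm (le_ciInf fun h => ?_) (le_ciInf fun X => ?_)
  -- `cap ≤ capRel`: the quotient at `h` is attained by `K Kᴴ`.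
  · have hh : (h.1 : Matrix (Fin n) (Fin n) ℂ).BlockTriangular id := h.2
    rw [relDet_map_eq_det_trun hp hq hpN hqN hT hh, relDet_conjTranspose_mul_self hp hpN hh]
    set K := gadget p hpN (h.1 : Matrix (Fin n) (Fin n) ℂ) with hK
    have hKd : K.det ≠ 0 := det_gadget_upper_ne_zero p hpN hh (GL_det_ne_zero _)
    have hKK : (K * Kᴴ).PosDef :=
      Matrix.PosDef.mul_conjTranspose_self K (Matrix.vecMul_injective_of_isUnit
        ((Matrix.isUnit_iff_isUnit_det K).2 (isUnit_iff_ne_zero.2 hKd)))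
    have hdet : (K * Kᴴ).det.re = Complex.normSq K.det := by
      have := det_conj_re' 1 K
      rwa [Matrix.mul_one, Matrix.det_one, Complex.one_re, mul_one] at this
    rw [← hdet]
    refine ciInf_le (f := fun X : {X : Matrix (Fin N) (Fin N) ℂ // X.PosDef} =>
      (trun p q hpN hqN T X.1).det.re / X.1.det.re) ⟨0, ?_⟩ ⟨K * Kᴴ, hKK⟩
    rintro _ ⟨X, rfl⟩
    exact div_nonneg (posSemidef_det_re_nonneg (htrun.posSemidef X.2.posSemidef))
      (posDef_det_re_pos X.2).le
  -- `capRel ≤ cap`: `U` has the same numerator as `X` and a denominator at least as large.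
  · obtain ⟨U, hU, hd, hXU⟩ := exists_upper_dual_gadget_eq hp hpN X.2
    refine (ciInf_le ⟨0, ?_⟩ (toUpperGL U hU hd)).trans ?_
    · rintro _ ⟨h, rfl⟩
      have hh : (h.1 : Matrix (Fin n) (Fin n) ℂ).BlockTriangular id := h.2
      simp only
      rw [relDet_map_eq_det_trun hp hq hpN hqN hT hh, relDet_conjTranspose_mul_self hp hpN hh]
      exact div_nonneg (posSemidef_det_re_nonneg
        (htrun.posSemidef (Matrix.posSemidef_self_mul_conjTranspose _))) (Complex.normSq_nonneg _)
    · have hval : ((toUpperGL U hU hd).1 : Matrix (Fin n) (Fin n) ℂ) = U := rfl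
      simp only [hval]
      rw [relDet_conjTranspose_mul_self hp hpN hU, ← hXU,
        ← det_gadget_re hq hqN (hT.posSemidef (hXU ▸ posSemidef_conj_diagonal p U))]
      exact div_le_div_of_nonneg_left
        (posSemidef_det_re_nonneg (htrun.posSemidef X.2.posSemidef)) (posDef_det_re_pos X.2)
        (det_le_of_dual_gadget_eq hpN X.2.posSemidef hU hd hXU)

end CapacityReduction


/-! ### Rank-nondecreasing maps -/

section Rank

variable {k l : ℕ}

theorem star_dotProduct_mul_mulVec {n m r t : ℕ} (x : Fin m → ℂ) (E : Matrix (Fin m) (Fin r) ℂ)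
    (A : Matrix (Fin r) (Fin t) ℂ) (F : Matrix (Fin t) (Fin n) ℂ) (y : Fin n → ℂ) :
    star x ⬝ᵥ (E * A * F) *ᵥ y = star (Eᴴ *ᵥ x) ⬝ᵥ A *ᵥ (F *ᵥ y) := by
  rw [← Matrix.mulVec_mulVec, ← Matrix.mulVec_mulVec, Matrix.star_mulVec,
    Matrix.conjTranspose_conjTranspose, Matrix.dotProduct_mulVec]

/-- A drop of rank at `X` is witnessed by the independent pair of `ker S(X)` and `range X`.
Conversely, if `X ⪰ 0` has range `R`, then every `L` independent of `R` lies in `ker S(X)`. -/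
theorem isRankNondecreasing_iff {S : Matrix (Fin k) (Fin k) ℂ →ₗ[ℂ] Matrix (Fin k) (Fin k) ℂ}
    (hS : IsCompletelyPositive S) : IsRankNondecreasing S ↔
      ∀ L R : Submodule ℂ (Fin k → ℂ), IsIndependent S L R →
        Module.finrank ℂ L + Module.finrank ℂ R ≤ k := by
  obtain ⟨r, A, hA⟩ := id hS
  have hker : ∀ M : Matrix (Fin k) (Fin k) ℂ,
      M.rank + Module.finrank ℂ (LinearMap.ker M.mulVecLin) = k := by
    intro M
    have := M.mulVecLin.finrank_range_add_finrank_ker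
    rwa [Module.finrank_fin_fun] at this
  constructor
  · intro h L R hLR
    rw [hA.isIndependent_iff] at hLR
    -- The rows of `M` form a basis of `R`, so `Mᵀ Mᵀᴴ` is positive semidefinite of rank `dim R`
    -- with range inside `R`.
    let b := Module.finBasis ℂ R
    let M : Matrix (Fin (Module.finrank ℂ R)) (Fin k) ℂ := Matrix.of fun i => (b i : Fin k → ℂ)
    have hM : M.rank = Module.finrank ℂ R := by
      have hli : LinearIndependent ℂ M.row :=
        b.linearIndependent.map' R.subtype (Submodule.ker_subtype R)
      rw [hli.rank_matrix, Fintype.card_fin]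
    have hMR : ∀ z, Mᵀ *ᵥ z ∈ R := by
      intro z
      have : Mᵀ *ᵥ z = ∑ i, z i • (b i : Fin k → ℂ) := by
        ext a
        simp [Matrix.mulVec, dotProduct, M, mul_comm]
      rw [this]
      exact R.sum_mem fun i _ => R.smul_mem _ (b i).2
    have hX : (Mᵀ * Mᵀᴴ).PosSemidef := Matrix.posSemidef_self_mul_conjTranspose _
    have h1 := h _ hX
    rw [Matrix.rank_self_mul_conjTranspose, Matrix.rank_transpose, hM] at h1
    have h2 : L ≤ LinearMap.ker (S (Mᵀ * Mᵀᴴ)).mulVecLin := by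
      intro x hx
      rw [LinearMap.mem_ker, Matrix.mulVecLin_apply,
        ← (hS.posSemidef hX).dotProduct_mulVec_zero_iff, hA, Matrix.sum_mulVec, dotProduct_sum]
      refine Finset.sum_eq_zero fun i _ => ?_
      rw [Matrix.mul_assoc, ← Matrix.mulVec_mulVec, ← Matrix.mulVec_mulVec, ← Matrix.mulVec_mulVec]
      exact hLR i x hx _ (hMR _)
    have h3 := Submodule.finrank_mono h2
    have h4 := hker (S (Mᵀ * Mᵀᴴ))
    omega
  · intro h X hX
    have h1 := h (LinearMap.ker (S X).mulVecLin) (LinearMap.range X.mulVecLin) ?_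
    · have h2 := hker (S X)
      have h3 : X.rank = Module.finrank ℂ (LinearMap.range X.mulVecLin) := rfl
      omega
    · rw [hA.isIndependent_iff]
      rintro i x hx _ ⟨z, rfl⟩
      rw [LinearMap.mem_ker, Matrix.mulVecLin_apply,
        ← (hS.posSemidef hX).dotProduct_mulVec_zero_iff, hA, Matrix.sum_mulVec, dotProduct_sum,
        Finset.sum_eq_zero_iff_of_nonneg] at hx
      · have h2 := hx i (Finset.mem_univ i)
        rw [star_dotProduct_mul_mulVec, hX.dotProduct_mulVec_zero_iff] at h2
        have h3 := star_dotProduct_mul_mulVec x (A i) X 1 z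
        rw [Matrix.mul_one, Matrix.one_mulVec, ← Matrix.mulVec_mulVec] at h3
        rw [Matrix.mulVecLin_apply, h3, Matrix.dotProduct_mulVec, ← hX.1, ← Matrix.star_mulVec,
          h2, star_zero, zero_dotProduct]
      · intro j _
        exact (hX.mul_mul_conjTranspose_same (A j)).dotProduct_mulVec_nonneg x

/-- The vectors supported on the first `d` coordinates. -/
def coordSubmodule (k d : ℕ) : Submodule ℂ (Fin k → ℂ) where
  carrier := {v | ∀ c : Fin k, d ≤ c → v c = 0}
  add_mem' hv hw c hc := by simp [hv c hc, hw c hc]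
  zero_mem' _ _ := rfl
  smul_mem' a v hv c hc := by simp [hv c hc]

theorem stdFlag_eq_coordSubmodule (i : Fin k) : stdFlag i = coordSubmodule k (i + 1) := by
  refine le_antisymm (Submodule.span_le.2 ?_) fun v hv => ?_
  · rintro _ ⟨j, hj, rfl⟩ c hc
    refine Pi.single_eq_of_ne ?_ _
    rintro rfl
    exact absurd (Fin.le_def.1 hj) (by omega)
  · rw [pi_eq_sum_univ' v]
    refine Submodule.sum_mem _ fun c _ => ?_
    by_cases hc : c ≤ i
    · refine Submodule.smul_mem _ _ (Submodule.subset_span ⟨c, hc, ?_⟩)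
      ext b
      simp [Pi.single_apply, eq_comm]
    · rw [hv c (Nat.succ_le_of_lt (not_le.1 hc)), zero_smul]
      exact Submodule.zero_mem _

/-- The vectors all of whose blocks lie in `L`. -/
def blockLift (lam : Fin k → ℕ) (hl : ∑ i, lam i = l) (L : Submodule ℂ (Fin k → ℂ)) :
    Submodule ℂ (Fin l → ℂ) :=
  ⨅ j, L.comap ((blockIncl lam hl j)ᴴ).mulVecLin

theorem mem_blockLift {lam : Fin k → ℕ} {hl : ∑ i, lam i = l} {L : Submodule ℂ (Fin k → ℂ)}
    {x : Fin l → ℂ} : x ∈ blockLift lam hl L ↔ ∀ j, (blockIncl lam hl j)ᴴ *ᵥ x ∈ L := by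
  simp [blockLift, Submodule.mem_iInf]

theorem blockIncl_conjTranspose_mulVec_family (lam : Fin k → ℕ) (hl : ∑ i, lam i = l)
    (w : Fin (Finset.univ.sup lam) → Fin k → ℂ) (j : Fin (Finset.univ.sup lam))
    (hw : w j ∈ coordSubmodule k (conjPart lam j)) :
    ((blockIncl lam hl j)ᴴ *ᵥ fun a => w (blk lam hl a) (col lam hl a)) = w j := by
  ext c
  rw [blockIncl_conjTranspose_mulVec]
  split_ifs with h
  · rw [blk_idx, col_idx]
  · exact (hw c (not_lt.1 h)).symm

/-- A vector with all blocks in `L` is a family of vectors in `L` supported on initial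
coordinates. -/
def blockLiftEquiv (lam : Fin k → ℕ) (hl : ∑ i, lam i = l) (L : Submodule ℂ (Fin k → ℂ)) :
    blockLift lam hl L ≃ₗ[ℂ] ∀ j, ↥(coordSubmodule k (conjPart lam j) ⊓ L) where
  toFun x j := ⟨(blockIncl lam hl j)ᴴ *ᵥ x, fun c hc => by
    rw [blockIncl_conjTranspose_mulVec, dif_neg (not_lt.2 hc)], mem_blockLift.1 x.2 j⟩
  map_add' x y := by
    ext j c
    simp [Matrix.mulVec_add]
  map_smul' a x := by
    ext j c
    simp [Matrix.mulVec_smul]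
  invFun w := ⟨fun a => (w (blk lam hl a) : Fin k → ℂ) (col lam hl a), by
    rw [mem_blockLift]
    intro j
    rw [blockIncl_conjTranspose_mulVec_family lam hl (fun j => (w j : Fin k → ℂ)) j (w j).2.1]
    exact (w j).2.2⟩
  left_inv x := by
    ext a
    simp only
    rw [blockIncl_conjTranspose_mulVec, dif_pos (col_lt lam hl a), idx_blk_col]
  right_inv w := funext fun j => Subtype.ext <|
    blockIncl_conjTranspose_mulVec_family lam hl (fun j => (w j : Fin k → ℂ)) j (w j).2.1

/-- The blocks can be chosen independently, a block of length `d` being any vector of `V_d ∩ L`;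
collecting blocks by length produces the coefficients `gap`. -/
theorem finrank_blockLift {lam : Fin k → ℕ} (h : Antitone lam) (hl : ∑ i, lam i = l)
    (L : Submodule ℂ (Fin k → ℂ)) : (Module.finrank ℂ (blockLift lam hl L) : ℝ) =
      ∑ i, gap (fun i => (lam i : ℝ)) i * (Module.finrank ℂ ↥(stdFlag i ⊓ L) : ℝ) := by
  rw [(blockLiftEquiv lam hl L).finrank_eq, Module.finrank_pi_fintype,
    sum_conjPart_apply h (fun d => Module.finrank ℂ ↥(coordSubmodule k d ⊓ L)), Nat.cast_sum]
  refine Finset.sum_congr rfl fun i _ => ?_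
  rw [gap_natCast h, smul_eq_mul, Nat.cast_mul, stdFlag_eq_coordSubmodule]

/-- The span of the blocks of the vectors in `L`. -/
def blockSpan (lam : Fin k → ℕ) (hl : ∑ i, lam i = l) (L : Submodule ℂ (Fin l → ℂ)) :
    Submodule ℂ (Fin k → ℂ) :=
  Submodule.span ℂ {v | ∃ j, ∃ x ∈ L, v = (blockIncl lam hl j)ᴴ *ᵥ x}

theorem le_blockLift_blockSpan (lam : Fin k → ℕ) (hl : ∑ i, lam i = l)
    (L : Submodule ℂ (Fin l → ℂ)) : L ≤ blockLift lam hl (blockSpan lam hl L) := fun x hx =>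
  mem_blockLift.2 fun j => Submodule.subset_span ⟨j, x, hx, rfl⟩

variable {n m N : ℕ} {p : Fin n → ℕ} {q : Fin m → ℕ}

/-- Each Kraus operator of `trun` is a Kraus operator of `T` between one block projection and one
block inclusion, so only the blocks of `x` and `y` are tested. -/
theorem trun_isIndependent_iff (hpN : ∑ i, p i = N) (hqN : ∑ i, q i = N) {r : ℕ}
    {T : Matrix (Fin n) (Fin n) ℂ →ₗ[ℂ] Matrix (Fin m) (Fin m) ℂ}
    {A : Fin r → Matrix (Fin m) (Fin n) ℂ} (hA : IsKraus T A)
    (L R : Submodule ℂ (Fin N → ℂ)) : IsIndependent (trun p q hpN hqN T) L R ↔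
      ∀ i j k, ∀ x ∈ L, ∀ y ∈ R,
        star ((blockIncl q hqN i)ᴴ *ᵥ x) ⬝ᵥ A k *ᵥ ((blockIncl p hpN j)ᴴ *ᵥ y) = 0 := by
  have htrun : ∀ X, trun p q hpN hqN T X =
      ∑ i : Fin (Finset.univ.sup q) × Fin (Finset.univ.sup p) × Fin r,
        (blockIncl q hqN i.1 * A i.2.2 * (blockIncl p hpN i.2.1)ᴴ) * X *
          (blockIncl q hqN i.1 * A i.2.2 * (blockIncl p hpN i.2.1)ᴴ)ᴴ := by
    intro X
    simp only [trun, LinearMap.comp_apply]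
    rw [gadget_isKraus q hqN, Fintype.sum_prod_type]
    refine Finset.sum_congr rfl fun i _ => ?_
    rw [(gadget_isKraus p hpN).dual, map_sum, Matrix.mul_sum, Matrix.sum_mul,
      Fintype.sum_prod_type]
    refine Finset.sum_congr rfl fun j _ => ?_
    rw [hA, Matrix.mul_sum, Matrix.sum_mul]
    refine Finset.sum_congr rfl fun k _ => ?_
    simp only [Matrix.conjTranspose_mul, Matrix.conjTranspose_conjTranspose, Matrix.mul_assoc]
  rw [isIndependent_iff_of_sum _ htrun, Prod.forall]
  refine forall_congr' fun i => ?_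
  rw [Prod.forall]
  simp only [star_dotProduct_mul_mulVec]

/-- Lifting an independent pair for `T` gives one for `trun` with the weighted dimensions.
Conversely, the block spans of an independent pair for `trun` are independent for `T`, and their
lifts contain the original pair. -/
theorem isRankNondecreasing_trun_iff (hp : Antitone p) (hq : Antitone q)
    (hpN : ∑ i, p i = N) (hqN : ∑ i, q i = N)
    {T : Matrix (Fin n) (Fin n) ℂ →ₗ[ℂ] Matrix (Fin m) (Fin m) ℂ} (hT : IsCompletelyPositive T) :
    IsRankNondecreasing (trun p q hpN hqN T) ↔
      IsRankNondecreasingRel T (fun i => (p i : ℝ)) (fun j => (q j : ℝ)) := by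
  obtain ⟨r, A, hA⟩ := id hT
  have hN : ∑ i, (p i : ℝ) = N := by rw [← hpN, Nat.cast_sum]
  rw [isRankNondecreasing_iff (trun_isCompletelyPositive p q hpN hqN hT)]
  constructor
  · intro h L R hLR
    rw [hA.isIndependent_iff] at hLR
    have h1 := h (blockLift q hqN L) (blockLift p hpN R) <|
      (trun_isIndependent_iff hpN hqN hA _ _).2 fun i j k x hx y hy =>
        hLR k _ (mem_blockLift.1 hx i) _ (mem_blockLift.1 hy j)
    rw [hN, ← finrank_blockLift hq hqN, ← finrank_blockLift hp hpN]
    exact_mod_cast h1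
  · intro h L R hLR
    rw [trun_isIndependent_iff hpN hqN hA] at hLR
    have h1 := h (blockSpan q hqN L) (blockSpan p hpN R) <| by
      rw [hA.isIndependent_iff]
      intro k x hx y hy
      induction hx using Submodule.span_induction with
      | mem x hx =>
        obtain ⟨i, x, hx, rfl⟩ := hx
        induction hy using Submodule.span_induction with
        | mem y hy =>
          obtain ⟨j, y, hy, rfl⟩ := hy
          exact hLR i j k x hx y hy
        | zero => simp
        | add y z _ _ hy hz => rw [Matrix.mulVec_add, dotProduct_add, hy, hz, add_zero]
        | smul a y _ hy => rw [Matrix.mulVec_smul, dotProduct_smul, hy, smul_zero]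
      | zero => simp
      | add x z _ _ hx hz => rw [star_add, add_dotProduct, hx, hz, add_zero]
      | smul a x _ hx => rw [star_smul, smul_dotProduct, hx, smul_zero]
    rw [hN, ← finrank_blockLift hq hqN, ← finrank_blockLift hp hpN] at h1
    have h2 := Submodule.finrank_mono (le_blockLift_blockSpan q hqN L)
    have h3 := Submodule.finrank_mono (le_blockLift_blockSpan p hpN R)
    have h4 : Module.finrank ℂ (blockLift q hqN (blockSpan q hqN L)) +
        Module.finrank ℂ (blockLift p hpN (blockSpan p hpN R)) ≤ N := by exact_mod_cast h1
    omega

end Rank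


/-! ### The Hilbert-Schmidt norm -/

section Norm

variable {k l : ℕ}

theorem trace_mul_conjTranspose_re (A : Matrix (Fin k) (Fin k) ℂ) :
    (A * Aᴴ).trace.re = ∑ i, ∑ j, ‖A i j‖ ^ 2 := by
  simp only [Matrix.trace, Matrix.diag_apply, Matrix.mul_apply, Matrix.conjTranspose_apply,
    Complex.re_sum]
  refine Finset.sum_congr rfl fun i _ => Finset.sum_congr rfl fun j _ => ?_
  rw [← Complex.normSq_eq_norm_sq, show A i j * star (A i j) = (Complex.normSq (A i j) : ℂ) from
    Complex.mul_conj _, Complex.ofReal_re]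

theorem hsNorm_sq (A : Matrix (Fin k) (Fin k) ℂ) : hsNorm A ^ 2 = (A * Aᴴ).trace.re := by
  rw [hsNorm, Real.sq_sqrt]
  rw [trace_mul_conjTranspose_re]
  positivity

theorem norm_apply_le_hsNorm (A : Matrix (Fin k) (Fin k) ℂ) (i j : Fin k) :
    ‖A i j‖ ≤ hsNorm A := by
  refine Real.le_sqrt_of_sq_le ?_
  rw [trace_mul_conjTranspose_re]
  calc ‖A i j‖ ^ 2 ≤ ∑ j, ‖A i j‖ ^ 2 :=
        Finset.single_le_sum (f := fun j => ‖A i j‖ ^ 2) (fun _ _ => sq_nonneg _)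
          (Finset.mem_univ j)
    _ ≤ ∑ i, ∑ j, ‖A i j‖ ^ 2 :=
        Finset.single_le_sum (f := fun i => ∑ j, ‖A i j‖ ^ 2)
          (fun _ _ => Finset.sum_nonneg fun _ _ => sq_nonneg _) (Finset.mem_univ i)

section Frobenius

open scoped Matrix.Norms.Frobenius

theorem hsNorm_eq_frobenius (A : Matrix (Fin k) (Fin k) ℂ) : hsNorm A = ‖A‖ := by
  rw [hsNorm, trace_mul_conjTranspose_re, Matrix.frobenius_norm_def, Real.sqrt_eq_rpow]
  simp

theorem exists_hsNorm_map_le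
    (f : Matrix (Fin k) (Fin k) ℂ →ₗ[ℂ] Matrix (Fin l) (Fin l) ℂ) :
    ∃ C : ℝ, 0 < C ∧ ∀ A, hsNorm (f A) ≤ C * hsNorm A := by
  obtain ⟨C, hC, h⟩ := (LinearMap.toContinuousLinearMap f).bound
  refine ⟨C, hC, fun A => ?_⟩
  rw [hsNorm_eq_frobenius, hsNorm_eq_frobenius]
  exact h A

end Frobenius

theorem hsNorm_unitary_conj {V : Matrix (Fin k) (Fin k) ℂ} (hV : V * Vᴴ = 1)
    (A : Matrix (Fin k) (Fin k) ℂ) : hsNorm (Vᴴ * A * V) = hsNorm A := by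
  rw [hsNorm, hsNorm]
  congr 2
  have h1 : Vᴴ * A * V * (Vᴴ * A * V)ᴴ = Vᴴ * (A * Aᴴ * V) := by
    simp only [Matrix.conjTranspose_mul, Matrix.conjTranspose_conjTranspose, Matrix.mul_assoc]
    rw [← Matrix.mul_assoc V, hV, Matrix.one_mul]
  rw [h1, Matrix.trace_mul_comm, Matrix.mul_assoc, hV, Matrix.mul_one]

end Norm

/-! ### Scalings of the reduction -/

section ScalingReduction

variable {n m N : ℕ} {p : Fin n → ℕ} {q : Fin m → ℕ}

/-- The image of an invertible upper triangular matrix under the gadget. -/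
def gadgetGL {k l : ℕ} (lam : Fin k → ℕ) (hl : ∑ i, lam i = l) (g : upperGL k) : GL (Fin l) ℂ :=
  Matrix.GeneralLinearGroup.mkOfDetNeZero (gadget lam hl (g.1 : Matrix (Fin k) (Fin k) ℂ))
    (det_gadget_upper_ne_zero lam hl g.2 (GL_det_ne_zero _))

theorem dual_trun (hpN : ∑ i, p i = N) (hqN : ∑ i, q i = N)
    (T : Matrix (Fin n) (Fin n) ℂ →ₗ[ℂ] Matrix (Fin m) (Fin m) ℂ) :
    dual (trun p q hpN hqN T) = trun q p hqN hpN (dual T) := by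
  rw [trun, dual_comp, dual_comp, dual_dual]
  rfl

theorem scaling_trun (hpN : ∑ i, p i = N) (hqN : ∑ i, q i = N)
    (T : Matrix (Fin n) (Fin n) ℂ →ₗ[ℂ] Matrix (Fin m) (Fin m) ℂ) (g : upperGL m)
    (h : upperGL n) : scaling (trun p q hpN hqN T) (gadgetGL q hqN g) (gadgetGL p hpN h) =
      trun p q hpN hqN (scaling T g.1 h.1) := by
  ext1 X
  have h1 : ((gadgetGL q hqN g : GL (Fin N) ℂ) : Matrix (Fin N) (Fin N) ℂ) =
    gadget q hqN (g.1 : Matrix (Fin m) (Fin m) ℂ) := rfl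
  have h2 : ((gadgetGL p hpN h : GL (Fin N) ℂ) : Matrix (Fin N) (Fin N) ℂ) =
    gadget p hpN (h.1 : Matrix (Fin n) (Fin n) ℂ) := rfl
  simp only [trun, LinearMap.comp_apply, scaling_apply, h1, h2]
  rw [dual_gadget_conj _ _ _ h.2, gadget_conj _ _ _ g.2]

/-- The real square roots of `lam`, on the diagonal. -/
def sqrtDiag {k : ℕ} (lam : Fin k → ℕ) : Matrix (Fin k) (Fin k) ℂ :=
  Matrix.diagonal fun i => (Real.sqrt (lam i) : ℂ)

theorem sqrtDiag_conjTranspose {k : ℕ} (lam : Fin k → ℕ) : (sqrtDiag lam)ᴴ = sqrtDiag lam := by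
  rw [sqrtDiag, Matrix.diagonal_conjTranspose]
  congr 1
  ext i
  simp

theorem sqrtDiag_mul_self {k : ℕ} (lam : Fin k → ℕ) :
    sqrtDiag lam * sqrtDiag lam = Matrix.diagonal fun i => (lam i : ℂ) := by
  rw [sqrtDiag, Matrix.diagonal_mul_diagonal]
  congr 1
  ext i
  rw [← Complex.ofReal_mul, Real.mul_self_sqrt (Nat.cast_nonneg _), Complex.ofReal_natCast]

theorem sqrtDiag_upper {k : ℕ} (lam : Fin k → ℕ) : (sqrtDiag lam).BlockTriangular id :=
  Matrix.blockTriangular_diagonal _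

theorem sqrtDiag_det_ne_zero {k : ℕ} {lam : Fin k → ℕ} (h : ∀ i, 0 < lam i) :
    (sqrtDiag lam).det ≠ 0 := by
  rw [sqrtDiag, Matrix.det_diagonal]
  refine Finset.prod_ne_zero_iff.2 fun i _ => ?_
  have : (0 : ℝ) < lam i := by exact_mod_cast h i
  exact_mod_cast (Real.sqrt_pos.2 this).ne'

theorem sqrtDiag_inv_mul_diagonal_mul {k : ℕ} {lam : Fin k → ℕ} (h : ∀ i, 0 < lam i) :
    (sqrtDiag lam)⁻¹ * (Matrix.diagonal fun i => (lam i : ℂ)) * (sqrtDiag lam)⁻¹ = 1 := by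
  have hu : IsUnit (sqrtDiag lam).det := isUnit_iff_ne_zero.2 (sqrtDiag_det_ne_zero h)
  rw [← sqrtDiag_mul_self, ← Matrix.mul_assoc, Matrix.nonsing_inv_mul _ hu, Matrix.one_mul,
    Matrix.mul_nonsing_inv _ hu]

theorem sqrtDiag_inv_conjTranspose {k : ℕ} (lam : Fin k → ℕ) :
    ((sqrtDiag lam)⁻¹)ᴴ = (sqrtDiag lam)⁻¹ := by
  rw [Matrix.conjTranspose_nonsing_inv, sqrtDiag_conjTranspose]

/-- The matrix `g diag(lam)^(-1/2)`. -/
def mulSqrtInv {k : ℕ} {lam : Fin k → ℕ} (h : ∀ i, 0 < lam i) (g : upperGL k) : upperGL k :=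
  toUpperGL ((g.1 : Matrix (Fin k) (Fin k) ℂ) * (sqrtDiag lam)⁻¹)
    (Matrix.BlockTriangular.mul g.2 (upper_inv (sqrtDiag_upper lam) (sqrtDiag_det_ne_zero h)))
    (by
      rw [Matrix.det_mul]
      exact mul_ne_zero (GL_det_ne_zero _) ((Matrix.isUnit_nonsing_inv_det_iff).2
        (isUnit_iff_ne_zero.2 (sqrtDiag_det_ne_zero h))).ne_zero)

/-- The factor `P^(-1/2)` cancels the image `P` of `1` under the adjoint gadget, and `Q^(-1/2)`
turns the target `Q` into `1`. The error is then the image of the original error under a fixed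
linear map, so `C` is independent of `T`, `g` and `h`; the same bound serves the dual map with `p`
and `q` exchanged. -/
theorem exists_hsNorm_trun_scaling_le (hp : Antitone p) (hpN : ∑ i, p i = N)
    (hqN : ∑ i, q i = N) (hp0 : ∀ i, 0 < p i) (hq0 : ∀ j, 0 < q j) :
    ∃ C : ℝ, 0 < C ∧ ∀ (T : Matrix (Fin n) (Fin n) ℂ →ₗ[ℂ] Matrix (Fin m) (Fin m) ℂ)
      (g : upperGL m) (h : upperGL n),
      hsNorm (trun p q hpN hqN (scaling T (mulSqrtInv hq0 g).1 (mulSqrtInv hp0 h).1) 1 - 1) ≤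
        C * hsNorm (scaling T g.1 h.1 1 - Matrix.diagonal fun j => (q j : ℂ)) := by
  obtain ⟨C, hC, hf⟩ := exists_hsNorm_map_le
    (gadget q hqN ∘ₗ LinearMap.mulLeft ℂ (sqrtDiag q)⁻¹ ∘ₗ LinearMap.mulRight ℂ (sqrtDiag q)⁻¹)
  refine ⟨C, hC, fun T g h => ?_⟩
  convert hf (scaling T g.1 h.1 1 - Matrix.diagonal fun j => (q j : ℂ)) using 2
  simp only [LinearMap.comp_apply, LinearMap.mulLeft_apply, LinearMap.mulRight_apply]
  rw [sub_mul, mul_sub, ← mul_assoc _ (Matrix.diagonal _), sqrtDiag_inv_mul_diagonal_mul hq0,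
    map_sub, gadget_one]
  congr 1
  simp only [trun, LinearMap.comp_apply]
  rw [dual_gadget_one hp]
  congr 1
  have h1 : ((mulSqrtInv hq0 g).1 : Matrix (Fin m) (Fin m) ℂ) =
    (g.1 : Matrix (Fin m) (Fin m) ℂ) * (sqrtDiag q)⁻¹ := rfl
  have h2 : ((mulSqrtInv hp0 h).1 : Matrix (Fin n) (Fin n) ℂ) =
    (h.1 : Matrix (Fin n) (Fin n) ℂ) * (sqrtDiag p)⁻¹ := rfl
  rw [scaling_apply, scaling_apply, h1, h2]
  simp only [Matrix.conjTranspose_mul, sqrtDiag_inv_conjTranspose]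
  have h3 : (h.1 : Matrix (Fin n) (Fin n) ℂ) * (sqrtDiag p)⁻¹ *
      (Matrix.diagonal fun i => (p i : ℂ)) *
      ((sqrtDiag p)⁻¹ * (h.1 : Matrix (Fin n) (Fin n) ℂ)ᴴ) =
      (h.1 : Matrix (Fin n) (Fin n) ℂ) * 1 * (h.1 : Matrix (Fin n) (Fin n) ℂ)ᴴ := by
    rw [← sqrtDiag_inv_mul_diagonal_mul hp0]
    simp only [Matrix.mul_assoc]
  rw [h3]
  simp only [Matrix.mul_assoc]

theorem isApproxScalable_trun_of (hp : Antitone p) (hq : Antitone q)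
    (hpN : ∑ i, p i = N) (hqN : ∑ i, q i = N) (hp0 : ∀ i, 0 < p i) (hq0 : ∀ j, 0 < q j)
    {T : Matrix (Fin n) (Fin n) ℂ →ₗ[ℂ] Matrix (Fin m) (Fin m) ℂ}
    (h : IsApproxScalable T (upperGL m) (upperGL n) 1 (Matrix.diagonal fun j => (q j : ℂ)) 1
      (Matrix.diagonal fun i => (p i : ℂ))) :
    IsApproxScalable (trun p q hpN hqN T) Set.univ Set.univ 1 1 1 1 := by
  intro ε hε
  obtain ⟨C, hC, hC'⟩ := exists_hsNorm_trun_scaling_le hp hpN hqN hp0 hq0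
  obtain ⟨D, hD, hD'⟩ := exists_hsNorm_trun_scaling_le hq hqN hpN hq0 hp0
  obtain ⟨g, hg, k, hk, h1, h2⟩ := h (min (ε / C) (ε / D)) (by positivity)
  refine ⟨gadgetGL q hqN (mulSqrtInv hq0 ⟨g, hg⟩), Set.mem_univ _,
    gadgetGL p hpN (mulSqrtInv hp0 ⟨k, hk⟩), Set.mem_univ _, ?_, ?_⟩
  · rw [scaling_trun]
    refine (hC' T ⟨g, hg⟩ ⟨k, hk⟩).trans ?_
    rw [← le_div_iff₀' hC]
    exact h1.trans (min_le_left _ _)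
  · rw [scaling_trun, dual_trun, dual_scaling]
    refine (hD' (dual T) ⟨k, hk⟩ ⟨g, hg⟩).trans ?_
    rw [← le_div_iff₀' hD, ← dual_scaling]
    exact h2.trans (min_le_right _ _)

end ScalingReduction

/-! ### Positive capacity of approximately scalable maps -/

section CapPositive

variable {N : ℕ}

/-- A nearly doubly stochastic matrix has a transversal of large entries. -/
theorem exists_transversal {M : Fin N → Fin N → ℝ} (h0 : ∀ j i, 0 ≤ M j i)
    (hrow : ∀ j, ∑ i, M j i ≤ 1 + 1 / (4 * (N + 1)))
    (hcol : ∀ i, 1 - 1 / (4 * (N + 1)) ≤ ∑ j, M j i) :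
    ∃ σ : Fin N → Fin N, Function.Injective σ ∧ ∀ i, 1 / (4 * (N + 1) ^ 2) ≤ M (σ i) i := by
  classical
  set δ : ℝ := 1 / (4 * (N + 1) ^ 2) with hδ
  set ε : ℝ := 1 / (4 * (N + 1)) with hε
  have hN : (0 : ℝ) ≤ N := Nat.cast_nonneg N
  have hε0 : 0 < ε := by positivity
  have hδ0 : 0 < δ := by positivity
  -- Hall's theorem for the graph of entries at least `δ`. If columns `s` had a smaller
  -- neighbourhood `t`, their mass, at least `|s| (1 - ε)`, would be at most `|t| (1 + ε) + N² δ`.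
  -- The constants make each of `|s| ε`, `|t| ε` and `N² δ` at most `1/4`, against a deficit `|s| -
  -- |t| ≥ 1`.
  obtain ⟨σ, hσ, h⟩ := (Finset.all_card_le_biUnion_card_iff_exists_injective
    (fun i : Fin N => Finset.univ.filter fun j => δ ≤ M j i)).1 (by
      intro s
      set t := s.biUnion fun i => Finset.univ.filter fun j => δ ≤ M j i with ht
      by_contra hlt
      have hst : (t.card : ℝ) + 1 ≤ s.card := by exact_mod_cast not_le.1 hlt
      have hsN : (s.card : ℝ) ≤ N := by
        exact_mod_cast (Finset.card_le_univ s).trans_eq (Fintype.card_fin N)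
      have h1 : (s.card : ℝ) * (1 - ε) ≤ ∑ i ∈ s, ∑ j, M j i := by
        rw [← nsmul_eq_mul]
        exact Finset.card_nsmul_le_sum _ _ _ fun i _ => hcol i
      have h2 : ∑ i ∈ s, ∑ j, M j i = ∑ i ∈ s, ∑ j ∈ t, M j i + ∑ i ∈ s, ∑ j ∈ tᶜ, M j i := by
        rw [← Finset.sum_add_distrib]
        exact Finset.sum_congr rfl fun i _ => (Finset.sum_add_sum_compl t _).symm
      have h3 : ∑ i ∈ s, ∑ j ∈ t, M j i ≤ t.card * (1 + ε) := by
        rw [Finset.sum_comm, ← nsmul_eq_mul]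
        refine Finset.sum_le_card_nsmul _ _ _ fun j _ => ?_
        exact (Finset.sum_le_sum_of_subset_of_nonneg (Finset.subset_univ s)
          fun i _ _ => h0 j i).trans (hrow j)
      have h4 : ∑ i ∈ s, ∑ j ∈ tᶜ, M j i ≤ N * (N * δ) := by
        have h5 : ∀ i ∈ s, ∑ j ∈ tᶜ, M j i ≤ N * δ := by
          intro i hi
          have h6 : ∑ j ∈ tᶜ, M j i ≤ (tᶜ).card • δ := by
            refine Finset.sum_le_card_nsmul _ _ _ fun j hj => ?_
            by_contra hlt'
            refine Finset.mem_compl.1 hj (Finset.mem_biUnion.2 ⟨i, hi, ?_⟩)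
            exact Finset.mem_filter.2 ⟨Finset.mem_univ _, (not_le.1 hlt').le⟩
          refine h6.trans ?_
          rw [nsmul_eq_mul]
          refine mul_le_mul_of_nonneg_right ?_ hδ0.le
          exact_mod_cast (Finset.card_le_univ tᶜ).trans_eq (Fintype.card_fin N)
        refine (Finset.sum_le_card_nsmul _ _ _ h5).trans ?_
        rw [nsmul_eq_mul]
        exact mul_le_mul_of_nonneg_right hsN (by positivity)
      have h7 : N * ε ≤ 1 / 4 := by
        rw [hε, mul_one_div, div_le_div_iff₀ (by positivity) (by norm_num)]
        linarith
      have h8 : N * (N * δ) ≤ 1 / 4 := by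
        rw [hδ, ← mul_assoc, mul_one_div, div_le_div_iff₀ (by positivity) (by norm_num)]
        nlinarith
      have h9 : (s.card : ℝ) * ε ≤ 1 / 4 := (mul_le_mul_of_nonneg_right hsN hε0.le).trans h7
      have h10 : (t.card : ℝ) * ε ≤ (s.card - 1) * ε :=
        mul_le_mul_of_nonneg_right (by linarith) hε0.le
      nlinarith)
  exact ⟨σ, hσ, fun i => (Finset.mem_filter.1 (h i)).2⟩

/-- The nonnegative matrix of entries `S(E_ii)_jj` has row sums read off from `S 1` and column sums
from `dual S 1`, so it has a transversal of large entries; keep only these in each diagonal entry.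
-/
theorem prod_diag_ge {S : Matrix (Fin N) (Fin N) ℂ →ₗ[ℂ] Matrix (Fin N) (Fin N) ℂ}
    (hS : IsCompletelyPositive S) (h1 : hsNorm (S 1 - 1) ≤ 1 / (4 * (N + 1)))
    (h2 : hsNorm (dual S 1 - 1) ≤ 1 / (4 * (N + 1))) {x : Fin N → ℝ} (hx : ∀ i, 0 ≤ x i) :
    (1 / (4 * (N + 1) ^ 2)) ^ N * ∏ i, x i ≤
      ∏ j, (S (Matrix.diagonal fun i => (x i : ℂ)) j j).re := by
  set M : Fin N → Fin N → ℝ := fun j i => (S (Matrix.single i i 1) j j).re with hM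
  have hsum : ∀ y : Fin N → ℝ, S (Matrix.diagonal fun i => (y i : ℂ)) =
      ∑ i, (y i : ℂ) • S (Matrix.single i i 1) := by
    intro y
    rw [← Matrix.sum_single_eq_diagonal, map_sum]
    refine Finset.sum_congr rfl fun i _ => ?_
    rw [← map_smul, Matrix.smul_single, smul_eq_mul, mul_one]
  have hre : ∀ (y : Fin N → ℝ) j,
      (S (Matrix.diagonal fun i => (y i : ℂ)) j j).re = ∑ i, M j i * y i := by
    intro y j
    rw [hsum, Matrix.sum_apply, Complex.re_sum]
    refine Finset.sum_congr rfl fun i _ => ?_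
    rw [Matrix.smul_apply, smul_eq_mul, Complex.re_ofReal_mul, mul_comm]
  have h0 : ∀ j i, 0 ≤ M j i := by
    intro j i
    have hps : (Matrix.single i i (1 : ℂ)).PosSemidef := by
      rw [← Matrix.diagonal_single]
      refine Matrix.PosSemidef.diagonal fun j => ?_
      by_cases h : j = i
      · subst h
        simp
      · simp [h]
    exact (Complex.le_def.1 (hS.posSemidef hps).diag_nonneg).1
  have hentry : ∀ (A : Matrix (Fin N) (Fin N) ℂ) i, |(A i i).re - 1| ≤ hsNorm (A - 1) := by
    intro A i
    have := (Complex.abs_re_le_norm _).trans (norm_apply_le_hsNorm (A - 1) i i)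
    simpa using this
  obtain ⟨σ, hσ, hσM⟩ := exists_transversal h0
    (fun j => by
      have e1 := hre (fun _ => 1) j
      simp only [Complex.ofReal_one, Matrix.diagonal_one, mul_one] at e1
      have e2 := (abs_le.1 ((hentry (S 1) j).trans h1)).2
      linarith)
    (fun i => by
      have e1 : (dual S 1 i i).re = ∑ j, M j i := by
        simp [dual, Matrix.trace, hM]
      have e2 := (abs_le.1 ((hentry (dual S 1) i).trans h2)).1
      linarith)
  have hbij : Function.Bijective σ := Finite.injective_iff_bijective.1 hσ
  have hconst : (1 / (4 * ((N : ℝ) + 1) ^ 2)) ^ N * ∏ i, x i =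
      ∏ i, (1 / (4 * ((N : ℝ) + 1) ^ 2) * x i) := by
    rw [Finset.prod_mul_distrib]
    simp
  rw [hconst, ← hbij.prod_comp fun j => (S (Matrix.diagonal fun i => (x i : ℂ)) j j).re]
  refine Finset.prod_le_prod (fun i _ => mul_nonneg (by positivity) (hx i)) fun i _ => ?_
  rw [hre]
  refine (mul_le_mul_of_nonneg_right (hσM i) (hx i)).trans ?_
  exact Finset.single_le_sum (f := fun i' => M (σ i) i' * x i')
    (fun i' _ => mul_nonneg (h0 _ _) (hx i')) (Finset.mem_univ i)

/-- Spectral decomposition, with the unitary in the general linear group. -/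
theorem exists_unitary_diagonal {A : Matrix (Fin N) (Fin N) ℂ} (hA : A.PosSemidef) :
    ∃ (V : GL (Fin N) ℂ) (x : Fin N → ℝ), (∀ i, 0 ≤ x i) ∧
      (V : Matrix (Fin N) (Fin N) ℂ) * (V : Matrix (Fin N) (Fin N) ℂ)ᴴ = 1 ∧
      A = V * (Matrix.diagonal fun i => (x i : ℂ)) * (V : Matrix (Fin N) (Fin N) ℂ)ᴴ := by
  have hV : (hA.1.eigenvectorUnitary : Matrix (Fin N) (Fin N) ℂ) *
      (hA.1.eigenvectorUnitary : Matrix (Fin N) (Fin N) ℂ)ᴴ = 1 :=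
    Matrix.mem_unitaryGroup_iff.1 hA.1.eigenvectorUnitary.2
  refine ⟨Matrix.GeneralLinearGroup.mkOfDetNeZero hA.1.eigenvectorUnitary ?_, hA.1.eigenvalues,
    hA.eigenvalues_nonneg, hV, ?_⟩
  · have := congrArg Matrix.det hV
    rw [Matrix.det_mul, Matrix.det_one] at this
    exact left_ne_zero_of_mul (this.trans_ne one_ne_zero)
  · have := hA.1.spectral_theorem
    rw [Unitary.conjStarAlgAut_apply] at this
    exact this

/-- Unitary scalings do not change the distance of either marginal from `1`. Taking the eigenbases
of `X` and of `S X` makes both matrices diagonal, and the determinants become the products in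
`prod_diag_ge`. -/
theorem det_map_ge {S : Matrix (Fin N) (Fin N) ℂ →ₗ[ℂ] Matrix (Fin N) (Fin N) ℂ}
    (hS : IsCompletelyPositive S) (h1 : hsNorm (S 1 - 1) ≤ 1 / (4 * (N + 1)))
    (h2 : hsNorm (dual S 1 - 1) ≤ 1 / (4 * (N + 1))) {X : Matrix (Fin N) (Fin N) ℂ}
    (hX : X.PosSemidef) : (1 / (4 * (N + 1) ^ 2)) ^ N * X.det.re ≤ (S X).det.re := by
  obtain ⟨U, x, hx, hU, hXU⟩ := exists_unitary_diagonal hX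
  obtain ⟨V, y, hy, hV, hSV⟩ := exists_unitary_diagonal (hS.posSemidef hX)
  have hV' := mul_eq_one_comm.1 hV
  have hU' := mul_eq_one_comm.1 hU
  have hnorm : ∀ (R : Matrix (Fin N) (Fin N) ℂ →ₗ[ℂ] Matrix (Fin N) (Fin N) ℂ)
      (A B : GL (Fin N) ℂ), (A : Matrix (Fin N) (Fin N) ℂ) * (A : Matrix (Fin N) (Fin N) ℂ)ᴴ = 1 →
      (B : Matrix (Fin N) (Fin N) ℂ) * (B : Matrix (Fin N) (Fin N) ℂ)ᴴ = 1 →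
      hsNorm (scaling R A B 1 - 1) = hsNorm (R 1 - 1) := by
    intro R A B hA hB
    rw [← hsNorm_unitary_conj hA (R 1 - 1), mul_sub, sub_mul, Matrix.mul_one,
      mul_eq_one_comm.1 hA, scaling_apply, Matrix.mul_one, hB]
  have hdiag : ∀ (W : Matrix (Fin N) (Fin N) ℂ) (z : Fin N → ℝ), W * Wᴴ = 1 →
      (W * (Matrix.diagonal fun i => (z i : ℂ)) * Wᴴ).det.re = ∏ i, z i := by
    intro W z hW
    rw [Matrix.det_mul, mul_comm, ← Matrix.det_mul, ← Matrix.mul_assoc,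
      mul_eq_one_comm.1 hW, Matrix.one_mul, Matrix.det_diagonal, ← Complex.ofReal_prod,
      Complex.ofReal_re]
  have key := prod_diag_ge (hS.scaling V U) ((hnorm S V U hV hU).trans_le h1)
    (by rw [dual_scaling]; exact (hnorm (dual S) U V hU hV).trans_le h2) hx
  have hval : scaling S V U (Matrix.diagonal fun i => (x i : ℂ)) =
      Matrix.diagonal fun i => (y i : ℂ) := by
    rw [scaling_apply, ← hXU, hSV, ← Matrix.mul_assoc, ← Matrix.mul_assoc, hV', Matrix.one_mul,
      Matrix.mul_assoc, hV', Matrix.mul_one]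
  rw [hval] at key
  simp only [Matrix.diagonal_apply_eq, Complex.ofReal_re] at key
  rw [hSV, hdiag _ _ hV]
  conv_lhs => rw [hXU, hdiag _ _ hU]
  exact key

/-- A single scaling with the tolerance of `det_map_ge` is enough: scaling by `g` and `k` multiplies
each quotient `det S(X) / det X`, after the change of variables, by the constant `|det g|² |det
k|²`. -/
theorem cap_pos_of_isApproxScalable
    {S : Matrix (Fin N) (Fin N) ℂ →ₗ[ℂ] Matrix (Fin N) (Fin N) ℂ} (hS : IsCompletelyPositive S)
    (h : IsApproxScalable S Set.univ Set.univ 1 1 1 1) : 0 < cap S := by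
  obtain ⟨g, -, k, -, h1, h2⟩ := h (1 / (4 * (N + 1))) (by positivity)
  set δ : ℝ := (1 / (4 * ((N : ℝ) + 1) ^ 2)) ^ N with hδ
  have hδ0 : 0 < δ := by positivity
  have hg : 0 < Complex.normSq (g : Matrix (Fin N) (Fin N) ℂ).det :=
    Complex.normSq_pos.2 (GL_det_ne_zero g)
  have hk : 0 < Complex.normSq (k : Matrix (Fin N) (Fin N) ℂ).det :=
    Complex.normSq_pos.2 (GL_det_ne_zero k)
  have : Nonempty {X : Matrix (Fin N) (Fin N) ℂ // X.PosDef} := ⟨⟨1, Matrix.PosDef.one⟩⟩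
  refine lt_of_lt_of_le (b := δ / (Complex.normSq (g : Matrix (Fin N) (Fin N) ℂ).det *
    Complex.normSq (k : Matrix (Fin N) (Fin N) ℂ).det)) (by positivity) (le_ciInf fun X => ?_)
  have hku : IsUnit (k : Matrix (Fin N) (Fin N) ℂ).det := isUnit_iff_ne_zero.2 (GL_det_ne_zero k)
  have hku' : IsUnit (k : Matrix (Fin N) (Fin N) ℂ)ᴴ.det := by
    rw [Matrix.det_conjTranspose]
    exact hku.star
  set Y : Matrix (Fin N) (Fin N) ℂ := (k : Matrix (Fin N) (Fin N) ℂ)⁻¹ * X.1 *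
    ((k : Matrix (Fin N) (Fin N) ℂ)⁻¹)ᴴ with hY
  have hYX : (k : Matrix (Fin N) (Fin N) ℂ) * Y * (k : Matrix (Fin N) (Fin N) ℂ)ᴴ = X.1 := by
    rw [hY, Matrix.conjTranspose_nonsing_inv, ← Matrix.mul_assoc, ← Matrix.mul_assoc,
      Matrix.mul_nonsing_inv _ hku, Matrix.one_mul, Matrix.mul_assoc,
      Matrix.nonsing_inv_mul _ hku', Matrix.mul_one]
  have h3 := det_map_ge (hS.scaling g k) h1 h2
    (X.2.posSemidef.mul_mul_conjTranspose_same (k : Matrix (Fin N) (Fin N) ℂ)⁻¹)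
  rw [← hY, scaling_apply, hYX, det_conj_re] at h3
  rw [div_le_div_iff₀ (mul_pos hg hk) (posDef_det_re_pos X.2)]
  have h4 := det_conj_re' Y (k : Matrix (Fin N) (Fin N) ℂ)
  rw [hYX] at h4
  rw [h4]
  calc δ * (Complex.normSq (k : Matrix (Fin N) (Fin N) ℂ).det * Y.det.re)
      = Complex.normSq (k : Matrix (Fin N) (Fin N) ℂ).det * (δ * Y.det.re) := by ring
    _ ≤ _ := mul_le_mul_of_nonneg_left h3 hk.le
    _ = _ := by ring

end CapPositive


/-! ### Near-minimizers of the capacity -/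

section NearMinimizer

/-- The shift matrix `E`, upper triangular with `E + Eᴴ = W - diag p`. -/
def upperHalf {n : ℕ} (p : Fin n → ℕ) (W : Matrix (Fin n) (Fin n) ℂ) : Matrix (Fin n) (Fin n) ℂ :=
  Matrix.of fun i j => if i < j then W i j else if i = j then ((((W i i).re - p i) / 2 : ℝ) : ℂ)
    else 0

theorem upperHalf_add_conjTranspose {n : ℕ} (p : Fin n → ℕ) {W : Matrix (Fin n) (Fin n) ℂ}
    (hW : W.IsHermitian) :
    upperHalf p W + (upperHalf p W)ᴴ = W - Matrix.diagonal fun i => (p i : ℂ) := by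
  ext i j
  simp only [Matrix.add_apply, Matrix.conjTranspose_apply, upperHalf, Matrix.of_apply,
    Matrix.sub_apply]
  rcases lt_trichotomy i j with h | h | h
  · simp [h, h.not_gt, h.ne, h.ne']
  · subst h
    have h1 : ((W i i).re : ℂ) = W i i := hW.coe_re_apply_self i
    simp only [lt_irrefl, if_false, if_true, Matrix.diagonal_apply_eq]
    rw [← h1, show star ((((((W i i).re : ℂ)).re - p i) / 2 : ℝ) : ℂ) = _ from
      Complex.conj_ofReal _]
    push_cast
    simp only [Complex.ofReal_re]
    ring
  · simp only [h, h.not_gt, h.ne', if_false, if_true, zero_add, h.ne]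
    rw [hW.apply, Matrix.diagonal_apply_ne _ h.ne', sub_zero]

/-- Supplies the uniform entry bound `N` for the matrices `W` and `E` in the perturbation estimate
below. -/
theorem norm_apply_le_trace {n : ℕ} {W : Matrix (Fin n) (Fin n) ℂ} (hW : W.PosSemidef)
    (i j : Fin n) : ‖W i j‖ ≤ W.trace.re := by
  obtain ⟨V, x, hx, hV, rfl⟩ := exists_unitary_diagonal hW
  have hVu : (V : Matrix (Fin n) (Fin n) ℂ) ∈ Matrix.unitaryGroup (Fin n) ℂ :=
    Matrix.mem_unitaryGroup_iff.2 hV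
  rw [Matrix.trace_mul_comm, ← Matrix.mul_assoc, mul_eq_one_comm.1 hV, Matrix.one_mul,
    Matrix.trace_diagonal, ← Complex.ofReal_sum, Complex.ofReal_re, Matrix.mul_apply]
  refine (norm_sum_le _ _).trans (Finset.sum_le_sum fun c _ => ?_)
  rw [Matrix.mul_diagonal, Matrix.conjTranspose_apply, norm_mul, norm_mul, norm_star,
    Complex.norm_real, Real.norm_of_nonneg (hx c)]
  have h1 := entry_norm_bound_of_unitary hVu i c
  have h2 := entry_norm_bound_of_unitary hVu j c
  calc _ ≤ 1 * x c * 1 := by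
        refine mul_le_mul ?_ h2 (norm_nonneg _) (by linarith [hx c])
        exact mul_le_mul_of_nonneg_right h1 (hx c)
    _ = x c := by ring

/-- A positive semidefinite matrix that nearly maximizes the relative determinant among those of
its trace is close to `diag p`. -/
theorem hsNorm_sub_diagonal_sq_le {n N : ℕ} {p : Fin n → ℕ} (hpN : ∑ i, p i = N)
    {W : Matrix (Fin n) (Fin n) ℂ} (hW : W.PosSemidef) (hWN : W.trace.re = N) {η t : ℝ}
    (ht : 0 < t) (htN : t * N ≤ 1 / 2)
    (h : ∀ U : Matrix (Fin n) (Fin n) ℂ, U.BlockTriangular id → U.det ≠ 0 →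
      ∏ c, Complex.normSq (U c c) ^ p c ≤
        (1 + η) * Real.exp ((W * (U * Uᴴ)).trace.re - N)) :
    hsNorm (W - Matrix.diagonal fun i => (p i : ℂ)) ^ 2 ≤
      t * (4 * N ^ 3 + n ^ 3 * N ^ 3) + η / t := by
  set E := upperHalf p W with hE
  set Δ := W - Matrix.diagonal fun i => (p i : ℂ) with hΔ
  have hN : (0 : ℝ) ≤ N := Nat.cast_nonneg N
  have hEΔ : E + Eᴴ = Δ := upperHalf_add_conjTranspose p hW.1
  have hWn : ∀ i j, ‖W i j‖ ≤ N := fun i j => hWN ▸ norm_apply_le_trace hW i j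
  set e : Fin n → ℝ := fun i => ((W i i).re - p i) / 2 with he
  have hEdiag : ∀ i, E i i = (e i : ℂ) := fun i => by simp [hE, upperHalf, he]
  have hpi : ∀ i, (p i : ℝ) ≤ N := fun i => by
    rw [← hpN]
    exact_mod_cast Finset.single_le_sum (f := p) (fun _ _ => Nat.zero_le _) (Finset.mem_univ i)
  have he_le : ∀ i, |e i| ≤ N := by
    intro i
    have h1 := abs_le.1 ((Complex.abs_re_le_norm _).trans (hWn i i))
    have h2 : (0 : ℝ) ≤ p i := Nat.cast_nonneg _
    have h3 := hpi i
    rw [he, abs_le]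
    constructor <;> simp only <;> linarith
  have hEn : ∀ i j, ‖E i j‖ ≤ N := by
    intro i j
    simp only [hE, upperHalf, Matrix.of_apply]
    split_ifs with h1 h2
    · exact hWn i j
    · rw [Complex.norm_real]
      exact he_le i
    · simp
  have hte : ∀ i, |t * e i| ≤ 1 / 2 := by
    intro i
    rw [abs_mul, abs_of_pos ht]
    exact (mul_le_mul_of_nonneg_left (he_le i) ht.le).trans htN
  have hEup : E.BlockTriangular id := by
    intro i j hij
    have hij' : j < i := hij
    simp [hE, upperHalf, hij'.not_gt, hij'.ne']
  -- The test direction in the triangular group: since `E + Eᴴ = Δ`, the first-order terms are `-t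
  -- Tr(diag p Δ)` for the logarithm of the left side of `h` and `-t Tr(W Δ)` for the exponent on
  -- the right. Comparing them produces `t ‖Δ‖²`.
  set U : Matrix (Fin n) (Fin n) ℂ := 1 - (t : ℂ) • E with hU
  have hUup : U.BlockTriangular id := by
    refine Matrix.blockTriangular_one.sub fun i j hij => ?_
    rw [Matrix.smul_apply, hEup hij, smul_zero]
  have hUdiag : ∀ i, U i i = ((1 - t * e i : ℝ) : ℂ) := by
    intro i
    rw [hU, Matrix.sub_apply, Matrix.one_apply_eq, Matrix.smul_apply, hEdiag, smul_eq_mul]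
    push_cast
    rfl
  have hpos : ∀ i, 0 < 1 - t * e i := fun i => by linarith [(abs_le.1 (hte i)).2]
  have hUdet : U.det ≠ 0 := by
    rw [Matrix.det_of_isUpperTriangular hUup]
    refine Finset.prod_ne_zero_iff.2 fun i _ => ?_
    rw [hUdiag]
    exact_mod_cast (hpos i).ne'
  have h1 := h U hUup hUdet
  have hlog : ∀ i, -(t * e i) - 2 * (t * e i) ^ 2 ≤ Real.log (1 - t * e i) := by
    intro i
    refine le_trans ?_ (Real.one_sub_inv_le_log_of_pos (hpos i))
    have h2 := abs_le.1 (hte i)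
    have h3 := hpos i
    rw [← sub_nonneg, show 1 - (1 - t * e i)⁻¹ - (-(t * e i) - 2 * (t * e i) ^ 2) =
      (t * e i) ^ 2 * (1 - 2 * (t * e i)) / (1 - t * e i) by field_simp; ring]
    exact div_nonneg (mul_nonneg (sq_nonneg _) (by linarith)) h3.le
  have hlower : Real.exp (∑ i, p i * (2 * (-(t * e i) - 2 * (t * e i) ^ 2))) ≤
      ∏ c, Complex.normSq (U c c) ^ p c := by
    rw [Real.exp_sum]
    refine Finset.prod_le_prod (fun i _ => (Real.exp_pos _).le) fun i _ => ?_
    rw [Real.exp_nat_mul, hUdiag, Complex.normSq_ofReal]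
    refine pow_le_pow_left₀ (Real.exp_pos _).le ?_ _
    rw [two_mul, Real.exp_add]
    have h4 : Real.exp (-(t * e i) - 2 * (t * e i) ^ 2) ≤ 1 - t * e i := by
      rw [← Real.le_log_iff_exp_le (hpos i)]
      exact hlog i
    exact mul_le_mul h4 h4 (Real.exp_pos _).le (hpos i).le
  have hupper : (1 + η) * Real.exp ((W * (U * Uᴴ)).trace.re - N) ≤
      Real.exp (η + ((W * (U * Uᴴ)).trace.re - N)) := by
    rw [Real.exp_add]
    refine mul_le_mul_of_nonneg_right ?_ (Real.exp_pos _).le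
    linarith [Real.add_one_le_exp η]
  have h5 := Real.exp_le_exp.1 (hlower.trans (h1.trans hupper))
  have hUU : U * Uᴴ = 1 - (t : ℂ) • Δ + ((t ^ 2 : ℝ) : ℂ) • (E * Eᴴ) := by
    rw [hU, Matrix.conjTranspose_sub, Matrix.conjTranspose_one, Matrix.conjTranspose_smul,
      show star (t : ℂ) = t from Complex.conj_ofReal t, ← hEΔ]
    simp only [sub_mul, mul_sub, one_mul, mul_one, Matrix.smul_mul, Matrix.mul_smul]
    push_cast
    module
  have htr : (W * (U * Uᴴ)).trace.re =
      N - t * (W * Δ).trace.re + t ^ 2 * (W * (E * Eᴴ)).trace.re := by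
    rw [hUU, mul_add, mul_sub, mul_one, mul_smul_comm, mul_smul_comm, Matrix.trace_add,
      Matrix.trace_sub, Matrix.trace_smul, Matrix.trace_smul, Complex.add_re, Complex.sub_re,
      smul_eq_mul, smul_eq_mul, Complex.re_ofReal_mul, Complex.re_ofReal_mul, hWN]
  have hPΔ : ((Matrix.diagonal fun i => (p i : ℂ)) * Δ).trace.re = ∑ i, p i * (2 * e i) := by
    simp only [Matrix.trace, Matrix.diag_apply, Matrix.diagonal_mul, Complex.re_sum]
    refine Finset.sum_congr rfl fun i _ => ?_
    rw [← Complex.ofReal_natCast, Complex.re_ofReal_mul, ← hEΔ, Matrix.add_apply,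
      Matrix.conjTranspose_apply, hEdiag]
    simp only [Complex.add_re, Complex.ofReal_re, Complex.star_def, Complex.conj_re]
    ring
  have hΔΔ : hsNorm Δ ^ 2 =
      (W * Δ).trace.re - ((Matrix.diagonal fun i => (p i : ℂ)) * Δ).trace.re := by
    have hΔH : Δᴴ = Δ := by
      rw [← hEΔ, Matrix.conjTranspose_add, Matrix.conjTranspose_conjTranspose, add_comm]
    rw [hsNorm_sq, hΔH, ← Complex.sub_re, ← Matrix.trace_sub, ← sub_mul]
  have hpe : ∑ i, (p i : ℝ) * e i ^ 2 ≤ N ^ 3 := by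
    calc ∑ i, (p i : ℝ) * e i ^ 2 ≤ ∑ i, (p i : ℝ) * N ^ 2 := by
          refine Finset.sum_le_sum fun i _ => mul_le_mul_of_nonneg_left ?_ (Nat.cast_nonneg _)
          exact sq_le_sq.2 ((he_le i).trans (le_abs_self _))
      _ = N ^ 3 := by
          rw [← Finset.sum_mul, ← Nat.cast_sum, hpN]
          ring
  have hWE : (W * (E * Eᴴ)).trace.re ≤ n ^ 3 * N ^ 3 := by
    refine (Complex.re_le_norm _).trans ?_
    have hterm : ∀ a b c, ‖W a b * (E b c * Eᴴ c a)‖ ≤ (N : ℝ) ^ 3 := by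
      intro a b c
      rw [norm_mul, norm_mul, Matrix.conjTranspose_apply, norm_star]
      calc ‖W a b‖ * (‖E b c‖ * ‖E a c‖) ≤ N * (N * N) := by
            refine mul_le_mul (hWn a b) ?_ (by positivity) hN
            exact mul_le_mul (hEn b c) (hEn a c) (norm_nonneg _) hN
        _ = (N : ℝ) ^ 3 := by ring
    simp only [Matrix.trace, Matrix.diag_apply, Matrix.mul_apply, Finset.mul_sum]
    calc _ ≤ ∑ a : Fin n, ∑ b : Fin n, ∑ c : Fin n, (N : ℝ) ^ 3 := by
          refine (norm_sum_le _ _).trans (Finset.sum_le_sum fun a _ => ?_)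
          refine (norm_sum_le _ _).trans (Finset.sum_le_sum fun b _ => ?_)
          exact (norm_sum_le _ _).trans (Finset.sum_le_sum fun c _ => hterm a b c)
      _ = n ^ 3 * N ^ 3 := by
          simp only [Finset.sum_const, Finset.card_univ, Fintype.card_fin, nsmul_eq_mul]
          ring
  have hsum : ∑ i, (p i : ℝ) * (2 * (-(t * e i) - 2 * (t * e i) ^ 2)) =
      -(t * ∑ i, p i * (2 * e i)) - 4 * t ^ 2 * ∑ i, (p i : ℝ) * e i ^ 2 := by
    rw [Finset.mul_sum, Finset.mul_sum, ← Finset.sum_neg_distrib, ← Finset.sum_sub_distrib]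
    exact Finset.sum_congr rfl fun i _ => by ring
  rw [hsum, ← hPΔ, htr] at h5
  -- The second-order errors are `4 N³` from the logarithms on the diagonal and `n³ N³` from `Tr(W E
  -- Eᴴ)`.
  have h6 : t * hsNorm Δ ^ 2 ≤ t ^ 2 * (4 * N ^ 3 + n ^ 3 * N ^ 3) + η := by
    have h7 := mul_le_mul_of_nonneg_left hpe (sq_nonneg t)
    have h8 := mul_le_mul_of_nonneg_left hWE (sq_nonneg t)
    rw [hΔΔ]
    linarith
  rw [← sub_nonneg, show t * (4 * N ^ 3 + n ^ 3 * N ^ 3) + η / t - hsNorm Δ ^ 2 =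
    (t ^ 2 * (4 * N ^ 3 + n ^ 3 * N ^ 3) + η - t * hsNorm Δ ^ 2) / t by field_simp]
  exact div_nonneg (by linarith) ht.le

end NearMinimizer

/-! ### Positive capacity implies approximate triangular scalability -/

section Scalable

variable {n m N : ℕ} {p : Fin n → ℕ} {q : Fin m → ℕ}

/-- Near-minimizers of the capacity, up to upper triangular changes of variables. -/
theorem exists_near_minimizer (hp : Antitone p) (hq : Antitone q)
    (hpN : ∑ i, p i = N) (hqN : ∑ i, q i = N) (hp0 : ∀ i, 0 < p i)
    {T : Matrix (Fin n) (Fin n) ℂ →ₗ[ℂ] Matrix (Fin m) (Fin m) ℂ} (hT : IsCompletelyPositive T)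
    (hcap : 0 < capRel T (fun i => (p i : ℝ)) (fun j => (q j : ℝ))) {η : ℝ} (hη : 0 < η) :
    ∃ H : Matrix (Fin n) (Fin n) ℂ, H.BlockTriangular id ∧ H.det ≠ 0 ∧
      0 < (gadget q hqN (T (H * Hᴴ))).det.re ∧
      ∀ U : Matrix (Fin n) (Fin n) ℂ, U.BlockTriangular id → U.det ≠ 0 →
        (gadget q hqN (T (H * Hᴴ))).det.re * ∏ c, Complex.normSq (U c c) ^ p c ≤
          (1 + η) * (gadget q hqN (T (H * U * (H * U)ᴴ))).det.re := by
  have hne : Nonempty (upperGL n) := ⟨toUpperGL 1 Matrix.blockTriangular_one (by simp)⟩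
  set f : upperGL n → ℝ := fun h =>
    relDet (fun j => (q j : ℝ)) (T ((h.1 : Matrix (Fin n) (Fin n) ℂ) *
      Matrix.diagonal (fun i => (((p i : ℝ)) : ℂ)) * (h.1 : Matrix (Fin n) (Fin n) ℂ)ᴴ)) /
      relDet (fun i => (p i : ℝ)) ((h.1 : Matrix (Fin n) (Fin n) ℂ)ᴴ *
        (h.1 : Matrix (Fin n) (Fin n) ℂ)) with hf
  have hfcap : capRel T (fun i => (p i : ℝ)) (fun j => (q j : ℝ)) = ⨅ h, f h := rfl
  -- Since `R Rᴴ = diag p`, the factor `diag p` inside `capRel` is absorbed by passing from `h` to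
  -- `H = h R`.
  set R := sqrtDiag p with hR
  have hRu : IsUnit R.det := isUnit_iff_ne_zero.2 (sqrtDiag_det_ne_zero hp0)
  have hRup : R.BlockTriangular id := sqrtDiag_upper p
  have hRi : R⁻¹.BlockTriangular id := upper_inv hRup hRu.ne_zero
  set D : Matrix (Fin n) (Fin n) ℂ → ℝ := fun U => Complex.normSq (gadget p hpN U).det with hD
  have hDmul : ∀ A B : Matrix (Fin n) (Fin n) ℂ, B.BlockTriangular id →
      D (A * B) = D A * D B := by
    intro A B hB
    simp only [hD]
    rw [gadget_mul _ _ _ hB, Matrix.det_mul, Complex.normSq_mul]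
  have hDpos : ∀ A : Matrix (Fin n) (Fin n) ℂ, A.BlockTriangular id → A.det ≠ 0 → 0 < D A :=
    fun A hA hd => Complex.normSq_pos.2 (det_gadget_upper_ne_zero p hpN hA hd)
  have hDprod : ∀ A : Matrix (Fin n) (Fin n) ℂ, A.BlockTriangular id →
      D A = ∏ c, Complex.normSq (A c c) ^ p c := by
    intro A hA
    simp only [hD]
    rw [det_gadget_upper hp hpN hA, map_prod]
    simp only [map_pow]
  have hfval : ∀ h : upperGL n, f h =
      (gadget q hqN (T ((h.1 : Matrix (Fin n) (Fin n) ℂ) * R *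
        ((h.1 : Matrix (Fin n) (Fin n) ℂ) * R)ᴴ))).det.re / D h.1 := by
    intro h
    simp only [hf, Complex.ofReal_natCast]
    rw [relDet_conjTranspose_mul_self hp hpN h.2,
      ← det_gadget_re hq hqN (hT.posSemidef (posSemidef_conj_diagonal p _)),
      ← sqrtDiag_mul_self, Matrix.conjTranspose_mul, hR, sqrtDiag_conjTranspose]
    simp only [Matrix.mul_assoc, hD]
  have hfnn : ∀ h, 0 ≤ f h := by
    intro h
    rw [hfval]
    refine div_nonneg (posSemidef_det_re_nonneg ?_) (Complex.normSq_nonneg _)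
    exact (gadget_isCompletelyPositive q hqN).posSemidef
      (hT.posSemidef (Matrix.posSemidef_self_mul_conjTranspose _))
  have hle : ∀ h, capRel T (fun i => (p i : ℝ)) (fun j => (q j : ℝ)) ≤ f h := fun h =>
    ciInf_le ⟨0, by rintro _ ⟨h, rfl⟩; exact hfnn h⟩ h
  -- Positivity of the capacity is what permits a multiplicative error `1 + η`.
  obtain ⟨h, hh⟩ := exists_lt_of_ciInf_lt (f := f)
    (a := (1 + η) * capRel T (fun i => (p i : ℝ)) (fun j => (q j : ℝ))) (by
      rw [← hfcap]
      nlinarith)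
  have hhd := GL_det_ne_zero h.1
  have hDh : 0 < D h.1 := hDpos _ h.2 hhd
  refine ⟨(h.1 : Matrix (Fin n) (Fin n) ℂ) * R, Matrix.BlockTriangular.mul h.2 hRup, ?_, ?_, ?_⟩
  · rw [Matrix.det_mul]
    exact mul_ne_zero hhd hRu.ne_zero
  · have := hcap.trans_le (hle h)
    rw [hfval] at this
    exact (div_pos_iff_of_pos_right hDh).1 this
  · intro U hU hUd
    -- The competitor with `V R = H U`. The factors of `R` and `R⁻¹` cancel in the denominator,
    -- which changes exactly by `∏ |U c c| ^ (2 p c)`.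
    set V : Matrix (Fin n) (Fin n) ℂ := (h.1 : Matrix (Fin n) (Fin n) ℂ) * R * U * R⁻¹ with hV
    have hVup : V.BlockTriangular id :=
      ((Matrix.BlockTriangular.mul h.2 hRup).mul hU).mul hRi
    have hVd : V.det ≠ 0 := by
      rw [hV, Matrix.det_mul, Matrix.det_mul, Matrix.det_mul]
      exact mul_ne_zero (mul_ne_zero (mul_ne_zero hhd hRu.ne_zero) hUd)
        ((Matrix.isUnit_nonsing_inv_det_iff).2 hRu).ne_zero
    have hVR : V * R = (h.1 : Matrix (Fin n) (Fin n) ℂ) * R * U := by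
      rw [hV, Matrix.mul_assoc _ R⁻¹, Matrix.nonsing_inv_mul _ hRu, Matrix.mul_one]
    have hDV : D V = D h.1 * D U := by
      have e1 : D R * D R⁻¹ = 1 := by
        rw [← hDmul _ _ hRi, Matrix.mul_nonsing_inv _ hRu]
        simp only [hD]
        rw [gadget_one, Matrix.det_one, Complex.normSq_one]
      rw [hV, hDmul _ _ hRi, hDmul _ _ hU, hDmul _ _ hRup]
      linear_combination D h.1 * D U * e1
    have h1 := hle (toUpperGL V hVup hVd)
    have hval : ((toUpperGL V hVup hVd).1 : Matrix (Fin n) (Fin n) ℂ) = V := rfl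
    rw [hfval, hval, hVR, hDV] at h1
    rw [hfval] at hh
    have hDU := hDpos U hU hUd
    rw [← hDprod U hU]
    have h2 := hh.le.trans (mul_le_mul_of_nonneg_left h1 (by linarith : (0 : ℝ) ≤ 1 + η))
    rw [← mul_div_assoc, div_le_div_iff₀ hDh (mul_pos hDh hDU)] at h2
    refine le_of_mul_le_mul_left ?_ hDh
    linarith

/-- When all parts are positive the first column has full length, so `Y` itself is one of the
blocks. -/
theorem det_ne_zero_of_det_gadget_ne_zero (hqN : ∑ i, q i = N) (hq0 : ∀ j, 0 < q j)
    {Y : Matrix (Fin m) (Fin m) ℂ} (hY : (gadget q hqN Y).det ≠ 0) : Y.det ≠ 0 := by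
  rcases Nat.eq_zero_or_pos m with rfl | hm
  · simp
  · have hcorner : ∀ {j : ℕ} (hj : j ≤ m), j = m → (corner hj Y).det = Y.det := by
      rintro j hj rfl
      rfl
    rw [det_gadget] at hY
    let j : Fin (Finset.univ.sup q) :=
      ⟨0, (hq0 ⟨0, hm⟩).trans_le (Finset.le_sup (f := q) (Finset.mem_univ _))⟩
    have hj : conjPart q j = m := by
      have : (Finset.univ.filter fun i => ((j : ℕ)) < q i) = Finset.univ :=
        Finset.filter_true_of_mem fun i _ => hq0 i
      rw [conjPart, this, Finset.card_univ, Fintype.card_fin]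
    rw [← hcorner (conjPart_le q j) hj]
    exact Finset.prod_ne_zero_iff.1 hY j (Finset.mem_univ _)

/-- With `H` a near-minimizer and `g` making the first marginal exact, the second marginal `W` has
trace `N`. Near-minimality, combined with `det_re_le_exp` applied to the perturbed and normalized
value of `T`, gives the hypothesis of `hsNorm_sub_diagonal_sq_le`, so `W` is close to `diag p`. -/
theorem isApproxScalable_of_capRel_pos (hp : Antitone p) (hq : Antitone q)
    (hpN : ∑ i, p i = N) (hqN : ∑ i, q i = N) (hp0 : ∀ i, 0 < p i) (hq0 : ∀ j, 0 < q j)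
    {T : Matrix (Fin n) (Fin n) ℂ →ₗ[ℂ] Matrix (Fin m) (Fin m) ℂ} (hT : IsCompletelyPositive T)
    (hcap : 0 < capRel T (fun i => (p i : ℝ)) (fun j => (q j : ℝ))) :
    IsApproxScalable T (upperGL m) (upperGL n) 1 (Matrix.diagonal fun j => (q j : ℂ)) 1
      (Matrix.diagonal fun i => (p i : ℂ)) := by
  intro ε hε
  set C : ℝ := 4 * N ^ 3 + n ^ 3 * N ^ 3 with hC
  have hC0 : 0 ≤ C := by positivity
  -- The first bound keeps the perturbation small enough, `t N ≤ 1/2`. The second makes the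
  -- quadratic error at most `ε²/2`; the choice `η = t ε²/2` makes the other term `η / t` equal to
  -- `ε²/2`.
  set t : ℝ := min (1 / (2 * (N + 1))) (ε ^ 2 / (2 * (C + 1))) with ht
  have ht0 : 0 < t := by positivity
  have htN : t * N ≤ 1 / 2 := by
    have h1 : t * (N + 1) ≤ 1 / 2 := by
      calc t * (N + 1) ≤ 1 / (2 * (N + 1)) * (N + 1) :=
            mul_le_mul_of_nonneg_right (min_le_left _ _) (by positivity)
        _ = 1 / 2 := by field_simp
    linarith
  have htC : t * C ≤ ε ^ 2 / 2 := by
    have h1 : t * (C + 1) ≤ ε ^ 2 / 2 := by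
      calc t * (C + 1) ≤ ε ^ 2 / (2 * (C + 1)) * (C + 1) :=
            mul_le_mul_of_nonneg_right (min_le_right _ _) (by positivity)
        _ = ε ^ 2 / 2 := by field_simp
    linarith
  obtain ⟨H, hH, hHd, hpos, hmin⟩ := exists_near_minimizer hp hq hpN hqN hp0 hT hcap
    (η := t * (ε ^ 2 / 2)) (by positivity)
  set Y := T (H * Hᴴ) with hY
  have hYps : Y.PosSemidef := hT.posSemidef (Matrix.posSemidef_self_mul_conjTranspose _)
  have hYpd : Y.PosDef := by
    refine hYps.posDef_iff_det_ne_zero.2 (det_ne_zero_of_det_gadget_ne_zero hqN hq0 fun h0 => ?_)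
    rw [h0] at hpos
    exact lt_irrefl _ hpos
  -- From `g gᴴ = Y⁻¹` it follows that `gᴴ Y g = 1`; the extra factor `Q^(1/2)` below turns this
  -- into `Q`.
  obtain ⟨g, hg, hgd, hgg⟩ := exists_upper_mul_conjTranspose hYpd.inv
  have hgY : gᴴ * Y * g = 1 := by
    have hYu : IsUnit Y.det := (Matrix.isUnit_iff_isUnit_det _).1 hYpd.isUnit
    rw [Matrix.mul_assoc, mul_eq_one_comm, Matrix.mul_assoc, hgg, Matrix.mul_nonsing_inv _ hYu]
  set R := sqrtDiag q with hR
  have hRd : R.det ≠ 0 := sqrtDiag_det_ne_zero hq0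
  set G := toUpperGL (g * R) (hg.mul (sqrtDiag_upper q))
    (by rw [Matrix.det_mul]; exact mul_ne_zero hgd hRd) with hG
  set K := toUpperGL H hH hHd with hK
  have hGv : (G.1 : Matrix (Fin m) (Fin m) ℂ) = g * R := rfl
  have hKv : (K.1 : Matrix (Fin n) (Fin n) ℂ) = H := rfl
  have hRH : Rᴴ = R := sqrtDiag_conjTranspose q
  have hval : ∀ X, scaling T G.1 K.1 X = R * (gᴴ * T (H * X * Hᴴ) * g) * R := by
    intro X
    rw [scaling_apply, hGv, hKv, Matrix.conjTranspose_mul, hRH]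
    simp only [Matrix.mul_assoc]
  have hone : scaling T G.1 K.1 1 = Matrix.diagonal fun j => (q j : ℂ) := by
    rw [hval, Matrix.mul_one, ← hY, hgY, Matrix.mul_one, hR, sqrtDiag_mul_self]
  have hcp := hT.scaling G.1 K.1
  refine ⟨G.1, G.2, K.1, K.2, ?_, ?_⟩
  · rw [hone, sub_self, hsNorm]
    simpa using hε.le
  set W := dual (scaling T G.1 K.1) 1 with hW
  have hWps : W.PosSemidef := hcp.dual.posSemidef Matrix.PosSemidef.one
  have htrace : ∀ X : Matrix (Fin n) (Fin n) ℂ, Xᴴ = X →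
      (W * X).trace.re = (scaling T G.1 K.1 X).trace.re := by
    intro X hX
    have h1 := trace_dual (scaling T G.1 K.1) X 1
    rw [hX, Matrix.mul_one, Matrix.trace_conjTranspose] at h1
    rw [Matrix.trace_mul_comm, hW, h1]
    exact Complex.conj_re _
  have hWN : W.trace.re = N := by
    have h1 := htrace 1 Matrix.conjTranspose_one
    rw [Matrix.mul_one, hone, Matrix.trace_diagonal, ← Nat.cast_sum, hqN] at h1
    simpa using h1
  have hgK := Complex.normSq_pos.2 (det_gadget_upper_ne_zero q hqN hg hgd)
  have hYg : Complex.normSq (gadget q hqN g).det * (gadget q hqN Y).det.re = 1 := by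
    rw [← det_conj_re, ← gadget_conj _ _ _ hg, hgY, gadget_one, Matrix.det_one, Complex.one_re]
  have key := hsNorm_sub_diagonal_sq_le hpN hWps hWN (η := t * (ε ^ 2 / 2)) ht0
    htN fun U hU hUd => by
      have hUH : (U * Uᴴ)ᴴ = U * Uᴴ := by
        rw [Matrix.conjTranspose_mul, Matrix.conjTranspose_conjTranspose]
      set A := gᴴ * T (H * (U * Uᴴ) * Hᴴ) * g with hA
      have hAps : A.PosSemidef := (hT.posSemidef
        ((Matrix.posSemidef_self_mul_conjTranspose U).mul_mul_conjTranspose_same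
          H)).conjTranspose_mul_mul_same g
      have h1 := hmin U hU hUd
      have h2 := det_re_le_exp ((gadget_isCompletelyPositive q hqN).posSemidef hAps)
      -- Both traces equal `Tr(diag q A)`. This links the determinant bound to the scaled map, and
      -- by duality to `Tr(W U Uᴴ)`.
      have h3 : (gadget q hqN A).trace = (R * A * R).trace := by
        rw [Matrix.trace_mul_comm, ← Matrix.mul_assoc, hR, sqrtDiag_mul_self, trace_gadget hq]
        simp [Matrix.trace, Matrix.diagonal_mul]
      rw [h3, ← hval, ← htrace _ hUH] at h2
      have h4 : (gadget q hqN A).det.re = Complex.normSq (gadget q hqN g).det *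
          (gadget q hqN (T (H * U * (H * U)ᴴ))).det.re := by
        rw [← det_conj_re, ← gadget_conj _ _ _ hg, hA, Matrix.conjTranspose_mul]
        simp only [Matrix.mul_assoc]
      rw [h4] at h2
      have h5 := mul_le_mul_of_nonneg_left h1 hgK.le
      rw [← mul_assoc, hYg, one_mul] at h5
      refine h5.trans ?_
      rw [mul_left_comm]
      exact mul_le_mul_of_nonneg_left h2 (by positivity)
  refine le_of_sq_le_sq ?_ hε.le
  refine key.trans ?_
  rw [mul_div_cancel_left₀ _ ht0.ne']
  linarith

end Scalable

end OpScaling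

end

theorem mainTheorem4 {n m N : ℕ} (p : Fin n → ℕ) (q : Fin m → ℕ)
    (hp : Antitone p) (hq : Antitone q)
    (hpN : ∑ i, p i = N) (hqN : ∑ i, q i = N)
    (T : Matrix (Fin n) (Fin n) ℂ →ₗ[ℂ] Matrix (Fin m) (Fin m) ℂ)
    (hT : OpScaling.IsCompletelyPositive T) :
    OpScaling.IsCompletelyPositive (OpScaling.trun p q hpN hqN T) ∧
    ((∀ i, 0 < p i) → (∀ j, 0 < q j) →
      (OpScaling.IsApproxScalable (OpScaling.trun p q hpN hqN T) Set.univ Set.univ 1 1 1 1 ↔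
        OpScaling.IsApproxScalable T (OpScaling.upperGL m) (OpScaling.upperGL n)
          1 (Matrix.diagonal fun j => (q j : ℂ)) 1 (Matrix.diagonal fun i => (p i : ℂ)))) ∧
    OpScaling.cap (OpScaling.trun p q hpN hqN T) =
      OpScaling.capRel T (fun i => (p i : ℝ)) (fun j => (q j : ℝ)) ∧
    (OpScaling.IsRankNondecreasing (OpScaling.trun p q hpN hqN T) ↔
      OpScaling.IsRankNondecreasingRel T (fun i => (p i : ℝ)) (fun j => (q j : ℝ))) := by
  refine ⟨OpScaling.trun_isCompletelyPositive p q hpN hqN hT, fun hp0 hq0 => ⟨fun h => ?_,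
    OpScaling.isApproxScalable_trun_of hp hq hpN hqN hp0 hq0⟩,
    OpScaling.cap_trun_eq_capRel hp hq hpN hqN hT,
    OpScaling.isRankNondecreasing_trun_iff hp hq hpN hqN hT⟩
  -- The scaling matrices of `trun` need not be images under the gadget, so they are used only to
  -- obtain positive capacity, which transfers to `T`.
  refine OpScaling.isApproxScalable_of_capRel_pos hp hq hpN hqN hp0 hq0 hT ?_
  rw [← OpScaling.cap_trun_eq_capRel hp hq hpN hqN hT]
  exact OpScaling.cap_pos_of_isApproxScalable
    (OpScaling.trun_isCompletelyPositive p q hpN hqN hT) h
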